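/- Let $q,m\ge 0$ and $n_1,\dots,n_q\ge 0$ be integers, $n=\sum_i n_i$, and write $x_p=(x_p^{(1)},\dots,x_p^{(q)})\in\mathbb R^n$ with $x_p^{(i)}\in\mathbb R^{n_i}$. Let $A\in\mathbb R^{n\times n}$, $B\in\mathbb R^{n\times m}$, $K\in\mathbb R^{m\times n}$, saturation levels $\bar u\in\mathbb R^m_{>0}$ and $0<T_1^{(i)}\le T_2^{(i)}$ $(i=1,\dots,q)$ be given. Let $\mathfrak{sat}_{\bar u}(v)_k=\min(|v_k|,\bar u_k)\operatorname{sign}(v_k)$, $\mathfrak{dz}_{\bar u}(y)=\mathfrak{sat}_{\bar u}(y)-y$, $$A_{cl}=\begin{bmatrix}A+BK&-BK\\0&A\end{bmatrix},\quad B_{cl}=\begin{bmatrix}B\\0\end{bmatrix},\quad K_{cl}=\begin{bmatrix}K&-K\end{bmatrix}.$$ For $x=(\bar x,\tau)=(x_p,\tilde\eta,\tau)\in\mathbb R^n\times\mathbb R^n\times\mathbb R^q$ put $\mathcal T=\prod_i[0,T_2^{(i)}]$, $\mathcal D_i=\{\tau\in\mathcal T:\tau_i=0\}$, $\mathcal C=\mathbb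 R^{2n}\times\mathcal T$, $\mathcal D=\mathbb R^{2n}\times\bigcup_i\mathcal D_i$, $f(x)=(A_{cl}\bar x+B_{cl}\mathfrak{dz}_{\bar u}(K_{cl}\bar x),-\mathbf 1_q)$, and $$G(x)=\bigcup_{i:\ \tau\in\mathcal D_i}\{x_p\}\times\{h_i(\tilde\eta)\}\times\{\chi\in\mathbb R^q:\chi_i\in[T_1^{(i)},T_2^{(i)}],\ \chi_k=\tau_k\ \forall k\ne i\},$$ where $h_i(\tilde\eta)$ is obtained from $\tilde\eta$ by replacing $\tilde\eta^{(i)}$ by $0$. Then $\mathcal C$ and $\mathcal D$ are closed, $f$ is continuous, and the set-valued map $G$ is outer semicontinuous and locally bounded on $\mathcal D$. Moreover, the hybrid system $\mathcal H$: $\dot x=f(x)$ for $x\in\mathcal C$, $x^+\in G(x)$ for $x\in\mathcal D$, is well-posed in the following sense. For a function $\rho\ge 0$ and the closed Euclidean unit ball $\mathbb B$, let $\mathcal H_\rho$ be the hybrid inclusion with flow set $\{x:(x+\rho(x)\mathbb B)\cap\mathcal C\neq\emptyset\}$, flow map $\overline{\operatorname{co}}\,f((x+\rho(x)\mathbb B)\cap\mathcal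 C)+\rho(x)\mathbb B$, jump set $\{x:(x+\rho(x)\mathbb B)\cap\mathcal D\ne\emptyset\}$ and jump map $\{v: v\in g+\rho(g)\mathbb B \text{ for some } g\in G((x+\rho(x)\mathbb B)\cap\mathcal D)\}$. Let $\rho\ge 0$ be continuous (possibly $\rho\equiv 0$), let $\delta_i>0$, $\delta_i\to 0$, and let $\phi_i$ be solutions to $\mathcal H_{\delta_i\rho}$ (hybrid arcs on hybrid time domains, locally absolutely continuous in $t$) whose graphs converge in the Painlevé–Kuratowski sense to a set $M$ and for which $\phi_i(0,0)\to x_0$. If $(\phi_i)$ is locally eventually bounded (for every $r$ there is a compact set containing $\phi_i(t,j)$ for all large $i$ and all $(t,j)\in\operatorname{dom}\phi_i$ with $t+j<r$), then $M$ is the graph of a solution to $\mathcal H$ starting at $x_0$. If $(\phi_i)$ is not locally eventually bounded, then there are $T>0$, $J\in\mathbb N$ and a solution $\phi$ to $\mathcal H$ starting at $x_0$ whose graph is $M\cap\{t+j<T+J\}$, for which $\{t:(t,J)\in\operatorname{dom}\phi\}=[s,T)$ for some $s<T$, and $\lim_{t\to T^-}|\phi(t,J)|=\infty$. -/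

import Mathlib

open Set Filter Topology MeasureTheory

noncomputable section

/-! ### Set-valued maps -/

section SetValued

variable {X Y : Type*}

/-- Outer semicontinuity of a set-valued map relative to a set `S`: limits of values
`y i ∈ G (x i)` along sequences `x i` in `S` converging to a point `x` of `S` belong to `G x`.
(For closed `S` this says that the graph of `G` restricted to `S` is closed.) -/
def OuterSemicontOn [TopologicalSpace X] [TopologicalSpace Y] (G : X → Set Y) (S : Set X) : Prop :=
  ∀ x ∈ S, ∀ y : Y, ∀ (xs : ℕ → X) (ys : ℕ → Y), (∀ i, xs i ∈ S) → (∀ i, ys i ∈ G (xs i)) →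
    Tendsto xs atTop (𝓝 x) → Tendsto ys atTop (𝓝 y) → y ∈ G x

/-- Local boundedness of a set-valued map relative to a set `S`: every point of `S` has a
neighbourhood `U` such that the image of `U ∩ S` is bounded. -/
def LocallyBoundedOn [TopologicalSpace X] [Bornology Y] (G : X → Set Y) (S : Set X) : Prop :=
  ∀ x ∈ S, ∃ U ∈ 𝓝 x, Bornology.IsBounded (⋃ z ∈ U ∩ S, G z)

/-- Convergence of a sequence of sets in the sense of Painlevé and Kuratowski:
the inner limit and the outer limit of `A` are both equal to `L`. -/
def SetConverges [TopologicalSpace X] (A : ℕ → Set X) (L : Set X) : Prop :=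
  {x | ∀ U ∈ 𝓝 x, ∀ᶠ i in atTop, (A i ∩ U).Nonempty} = L ∧
  {x | ∀ U ∈ 𝓝 x, ∃ᶠ i in atTop, (A i ∩ U).Nonempty} = L

end SetValued

/-! ### Hybrid time domains, hybrid arcs and hybrid systems -/

/-- A compact hybrid time domain: a finite union of sets `[t j, t (j + 1)] × {j}`,
`j = 0, …, J`, with `0 = t 0 ≤ t 1 ≤ ⋯ ≤ t (J + 1)`. -/
def IsCompactHybridTimeDomain (E : Set (ℝ × ℕ)) : Prop :=
  ∃ (J : ℕ) (t : ℕ → ℝ), t 0 = 0 ∧ Monotone t ∧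
    E = {p | p.2 ≤ J ∧ t p.2 ≤ p.1 ∧ p.1 ≤ t (p.2 + 1)}

/-- A hybrid time domain: a nonempty set all of whose truncations
`E ∩ ([0, T] × {0, …, J})`, `(T, J) ∈ E`, are compact hybrid time domains. -/
def IsHybridTimeDomain (E : Set (ℝ × ℕ)) : Prop :=
  E.Nonempty ∧ ∀ p ∈ E, IsCompactHybridTimeDomain (E ∩ Icc 0 p.1 ×ˢ Iic p.2)

/-- A hybrid arc: a function on a hybrid time domain, locally absolutely continuous in `t` for
each `j`. The values of `val` outside `dom` are irrelevant. -/
structure HybridArc (E : Type*) [NormedAddCommGroup E] [NormedSpace ℝ E] where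
  /-- the domain -/
  dom : Set (ℝ × ℕ)
  /-- the value at hybrid time `(t, j)` -/
  val : ℝ → ℕ → E
  isHybridTimeDomain : IsHybridTimeDomain dom
  locallyAC : ∀ (j : ℕ) (a b : ℝ), a ≤ b → (∀ t ∈ Icc a b, (t, j) ∈ dom) →
    AbsolutelyContinuousOnInterval (fun t => val t j) a b

/-- A hybrid system `ẋ ∈ F x` on `C`, `x⁺ ∈ G x` on `D`. -/
structure HybridSystem (E : Type*) where
  /-- flow set -/
  C : Set E
  /-- flow map -/
  F : E → Set E
  /-- jump set -/
  D : Set E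
  /-- jump map -/
  G : E → Set E

section Hybrid

variable {E : Type*} [NormedAddCommGroup E] [NormedSpace ℝ E]

/-- The graph of a hybrid arc. -/
def HybridArc.graph (φ : HybridArc E) : Set (ℝ × ℕ × E) :=
  {p | (p.1, p.2.1) ∈ φ.dom ∧ p.2.2 = φ.val p.1 p.2.1}

/-- A hybrid arc is a solution to `H` if it starts in `closure C ∪ D`, flows in `C` according to
the flow map, and jumps from `D` according to the jump map. -/
structure HybridSystem.IsSolution (H : HybridSystem E) (φ : HybridArc E) : Prop where
  init : φ.val 0 0 ∈ closure H.C ∪ H.D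
  flow_mem : ∀ j : ℕ, ∀ t ∈ interior {s : ℝ | (s, j) ∈ φ.dom}, φ.val t j ∈ H.C
  flow_deriv : ∀ j : ℕ, ∀ᵐ t : ℝ, (t, j) ∈ φ.dom →
    ∃ v ∈ H.F (φ.val t j), HasDerivAt (fun s => φ.val s j) v t
  jump : ∀ (t : ℝ) (j : ℕ), (t, j) ∈ φ.dom → (t, j + 1) ∈ φ.dom →
    φ.val t j ∈ H.D ∧ φ.val t (j + 1) ∈ H.G (φ.val t j)

/-- The `ρ`-perturbation of a hybrid system: with `B` the closed unit ball,
`C_ρ = {x | (x + ρ x B) ∩ C ≠ ∅}`, `F_ρ x = cl con F ((x + ρ x B) ∩ C) + ρ x B`,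
`D_ρ = {x | (x + ρ x B) ∩ D ≠ ∅}`,
`G_ρ x = {v | v ∈ g + ρ g B for some g ∈ G ((x + ρ x B) ∩ D)}`. -/
def HybridSystem.perturb (H : HybridSystem E) (ρ : E → ℝ) : HybridSystem E where
  C := {x | (Metric.closedBall x (ρ x) ∩ H.C).Nonempty}
  F := fun x => {v | ∃ w ∈ closedConvexHull ℝ (⋃ y ∈ Metric.closedBall x (ρ x) ∩ H.C, H.F y),
    v ∈ Metric.closedBall w (ρ x)}
  D := {x | (Metric.closedBall x (ρ x) ∩ H.D).Nonempty}
  G := fun x => {v | ∃ y ∈ Metric.closedBall x (ρ x) ∩ H.D, ∃ g ∈ H.G y,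
    v ∈ Metric.closedBall g (ρ g)}

/-- A sequence of hybrid arcs is locally eventually bounded if for each `m` the arcs restricted to
`t + j < m` eventually take values in one compact set. -/
def LocallyEventuallyBounded (φ : ℕ → HybridArc E) : Prop :=
  ∀ m : ℝ, ∃ K : Set E, IsCompact K ∧ ∀ᶠ i in atTop, ∀ (t : ℝ) (j : ℕ),
    (t, j) ∈ (φ i).dom → t + j < m → (φ i).val t j ∈ K

/-- Well-posedness of a hybrid system. Let `φ i` be solutions to the `δ i • ρ`-perturbations of
`H`, where `ρ ≥ 0` is continuous and `δ i > 0` tends to `0` (the choice `ρ = 0` covers sequences of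
solutions to `H` itself), let the `φ i` converge graphically, with graphical limit `M`, and let
their initial values converge to `x₀`. Then
* if the sequence is locally eventually bounded, `M` is the graph of a solution to `H` that starts
  at `x₀`;
* otherwise, `M` truncated to `t + j < T + J`, for some hybrid time `(T, J)`, is the graph of a
  solution to `H` that starts at `x₀` and blows up as `t → T` during the flow after jump `J`. -/
def HybridSystem.WellPosed (H : HybridSystem E) : Prop :=
  ∀ (ρ : E → ℝ), Continuous ρ → (∀ x, 0 ≤ ρ x) →
  ∀ (δ : ℕ → ℝ), (∀ i, 0 < δ i) → Tendsto δ atTop (𝓝 0) →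
  ∀ (φ : ℕ → HybridArc E) (x₀ : E) (M : Set (ℝ × ℕ × E)),
    (∀ i, (H.perturb (fun x => δ i * ρ x)).IsSolution (φ i)) →
    SetConverges (fun i => (φ i).graph) M →
    Tendsto (fun i => (φ i).val 0 0) atTop (𝓝 x₀) →
    (LocallyEventuallyBounded φ →
      ∃ ψ : HybridArc E, H.IsSolution ψ ∧ ψ.val 0 0 = x₀ ∧ ψ.graph = M) ∧
    (¬ LocallyEventuallyBounded φ →
      ∃ (ψ : HybridArc E) (T : ℝ) (J : ℕ), H.IsSolution ψ ∧ ψ.val 0 0 = x₀ ∧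
        (∃ s < T, ∀ t : ℝ, (t, J) ∈ ψ.dom ↔ s ≤ t ∧ t < T) ∧
        Tendsto (fun t => ‖ψ.val t J‖) (𝓝[<] T) atTop ∧
        ψ.graph = {p ∈ M | p.1 + (p.2.1 : ℝ) < T + J})

end Hybrid

/-! ### The closed-loop system

`q` is the number of groups of plant states, `ν i` is the size `nᵢ` of group `i`. A vector of
`ℝⁿ`, `n = n₁ + ⋯ + n_q`, is indexed by pairs consisting of a group and a position in it. -/

/-- Indices of the plant state, in groups. -/
abbrev Blk {q : ℕ} (ν : Fin q → ℕ) : Type := (i : Fin q) × Fin (ν i)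

/-- The state space `ℝ^{2n} × ℝ^q`, with state `x = (x_p, η̃, τ)`. -/
abbrev ClState {q : ℕ} (ν : Fin q → ℕ) : Type := EuclideanSpace ℝ ((Blk ν ⊕ Blk ν) ⊕ Fin q)

/-- The decentralized saturation with levels `u`. -/
def satVec {m : ℕ} (u v : Fin m → ℝ) : Fin m → ℝ := fun k => min |v k| (u k) * Real.sign (v k)

/-- The decentralized deadzone `dz y = sat y - y`. -/
def dzVec {m : ℕ} (u y : Fin m → ℝ) : Fin m → ℝ := satVec u y - y

namespace ClosedLoop

variable {q m : ℕ} {ν : Fin q → ℕ}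

/-- The component `x̄ = (x_p, η̃)`. -/
def xbar (x : ClState ν) : Blk ν ⊕ Blk ν → ℝ := fun k => x (Sum.inl k)

/-- The component `x_p`. -/
def xp (x : ClState ν) : Blk ν → ℝ := fun k => x (Sum.inl (Sum.inl k))

/-- The component `η̃`. -/
def err (x : ClState ν) : Blk ν → ℝ := fun k => x (Sum.inl (Sum.inr k))

/-- The timers `τ`. -/
def timer (x : ClState ν) : Fin q → ℝ := fun i => x (Sum.inr i)

/-- `A_cl = [A + B K, -B K; 0, A]`. -/
def Acl (A : Matrix (Blk ν) (Blk ν) ℝ) (B : Matrix (Blk ν) (Fin m) ℝ)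
    (K : Matrix (Fin m) (Blk ν) ℝ) : Matrix (Blk ν ⊕ Blk ν) (Blk ν ⊕ Blk ν) ℝ :=
  Matrix.fromBlocks (A + B * K) (-(B * K)) 0 A

/-- `B_cl = [B; 0]`. -/
def Bcl (B : Matrix (Blk ν) (Fin m) ℝ) : Matrix (Blk ν ⊕ Blk ν) (Fin m) ℝ :=
  Matrix.fromRows B 0

/-- `K_cl = [K, -K]`. -/
def Kcl (K : Matrix (Fin m) (Blk ν) ℝ) : Matrix (Fin m) (Blk ν ⊕ Blk ν) ℝ :=
  Matrix.fromCols K (-K)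

/-- The flow map `f x = (A_cl x̄ + B_cl dz (K_cl x̄), -1)`. -/
def flowMap (A : Matrix (Blk ν) (Blk ν) ℝ) (B : Matrix (Blk ν) (Fin m) ℝ)
    (K : Matrix (Fin m) (Blk ν) ℝ) (u : Fin m → ℝ) (x : ClState ν) : ClState ν :=
  WithLp.toLp 2 (Sum.elim
    ((Acl A B K).mulVec (xbar x) + (Bcl B).mulVec (dzVec u ((Kcl K).mulVec (xbar x))))
    (fun _ => -1))

/-- `𝒯`, the product of the intervals `[0, T₂ i]`. -/
def timerSet (T₂ : Fin q → ℝ) : Set (Fin q → ℝ) := {τ | ∀ i, τ i ∈ Icc 0 (T₂ i)}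

/-- `𝒟ᵢ = {τ ∈ 𝒯 | τ i = 0}`. -/
def timerJumpSet (T₂ : Fin q → ℝ) (i : Fin q) : Set (Fin q → ℝ) := {τ ∈ timerSet T₂ | τ i = 0}

/-- The flow set `𝒞 = ℝ^{2n} × 𝒯`. -/
def flowSet (ν : Fin q → ℕ) (T₂ : Fin q → ℝ) : Set (ClState ν) := {x | timer x ∈ timerSet T₂}

/-- The jump set `𝒟`, the product of `ℝ^{2n}` and the union of the sets `𝒟ᵢ`. -/
def jumpSet (ν : Fin q → ℕ) (T₂ : Fin q → ℝ) : Set (ClState ν) :=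
  {x | timer x ∈ ⋃ i, timerJumpSet T₂ i}

/-- `Ĝᵢ τ`: timer `i` is reset into `[T₁ i, T₂ i]`, the others are kept. -/
def timerReset (T₁ T₂ : Fin q → ℝ) (i : Fin q) (τ : Fin q → ℝ) : Set (Fin q → ℝ) :=
  {χ | χ i ∈ Icc (T₁ i) (T₂ i) ∧ ∀ k, k ≠ i → χ k = τ k}

/-- `hᵢ`: the block diagonal matrix with blocks `0` (group `i`) and `I` (other groups),
applied to `η̃`. -/
def errReset (i : Fin q) (e : Blk ν → ℝ) : Blk ν → ℝ :=
  (Matrix.blockDiagonal' (fun j : Fin q =>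
    if i = j then (0 : Matrix (Fin (ν j)) (Fin (ν j)) ℝ) else 1)).mulVec e

/-- `𝒥 (η̃, τ)`, the union of `{hᵢ η̃} × Ĝᵢ τ` over all `i` with `τ ∈ 𝒟ᵢ`. -/
def resetSet (T₁ T₂ : Fin q → ℝ) (e : Blk ν → ℝ) (τ : Fin q → ℝ) :
    Set ((Blk ν → ℝ) × (Fin q → ℝ)) :=
  ⋃ i ∈ {k : Fin q | τ ∈ timerJumpSet T₂ k}, {errReset i e} ×ˢ timerReset T₁ T₂ i τ

/-- The jump map `G x = {x_p} × 𝒥 (η̃, τ)`; it is empty outside the jump set. -/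
def jumpMap (T₁ T₂ : Fin q → ℝ) (x : ClState ν) : Set (ClState ν) :=
  {y | xp y = xp x ∧ (err y, timer y) ∈ resetSet T₁ T₂ (err x) (timer x)}

/-- The closed-loop hybrid system. -/
def system (A : Matrix (Blk ν) (Blk ν) ℝ) (B : Matrix (Blk ν) (Fin m) ℝ)
    (K : Matrix (Fin m) (Blk ν) ℝ) (u : Fin m → ℝ) (T₁ T₂ : Fin q → ℝ) :
    HybridSystem (ClState ν) where
  C := flowSet ν T₂
  F := fun x => {flowMap A B K u x}
  D := jumpSet ν T₂
  G := jumpMap T₁ T₂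

end ClosedLoop

end

/-!
Closedness, continuity, outer semicontinuity and local boundedness of the data are read off from
their definitions: saturation is a clamp, and the graph of the jump map is a finite union of closed
sets. Well-posedness then follows from two facts.

* *There is no escape in finite hybrid time.* The flow map grows linearly, because
  `‖dz y‖ ≤ ‖y‖`, and a jump increases the norm by at most a constant. The perturbation `δ i * ρ` is
  eventually small on any given ball, however fast `ρ` grows. Continuous induction along flow
  intervals and induction over jumps show that solutions to the perturbed systems with convergent
  initial values are bounded by `C * exp (l * (t + j))` on each truncation `t + j < m`, for all
  large `i` (`HybridSystem.IsSolution.one_add_norm_le_mul_exp`). Every sequence that the definition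
  of well-posedness considers is therefore locally eventually bounded, so that its second
  alternative does not occur for this system (`HybridSystem.locallyEventuallyBounded_of_linear_growth`).

* *Locally eventually bounded graphical limits are solutions.* Boundedness bounds the velocities,
  hence the arcs are equi-Lipschitz in `t` and the graphical limit is single-valued. Jump times
  converge along an ultrafilter, so the limit lives on a hybrid time domain
  (`isHybridTimeDomain_graphicalLimit`, `exists_hybridArc_graph_eq`). As the flow map is
  single-valued and continuous, a mean value inequality for absolutely continuous curves passes to
  the limit and shows that the limit is differentiable with the nominal velocity at every interior
  point of a flow interval (`HybridSystem.hasDerivAt_graphicalLimit`). Jumps of the limit are limits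
  of jumps (`HybridSystem.exists_tendsto_jump`), to which closedness of the jump set and outer
  semicontinuity of the jump map apply.
-/

variable {E : Type*} [NormedAddCommGroup E] [NormedSpace ℝ E]

/-! ### Absolutely continuous curves -/

theorem LipschitzWith.comp_absolutelyContinuousOnInterval {X Y : Type*} [PseudoMetricSpace X]
    [PseudoMetricSpace Y] {g : X → Y} {C : NNReal} (hg : LipschitzWith C g) {φ : ℝ → X} {a b : ℝ}
    (hφ : AbsolutelyContinuousOnInterval φ a b) :
    AbsolutelyContinuousOnInterval (fun t => g (φ t)) a b := by
  unfold AbsolutelyContinuousOnInterval at hφ ⊢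
  refine squeeze_zero (fun t => Finset.sum_nonneg fun i _ => dist_nonneg) (fun t => ?_)
    (by simpa using hφ.const_mul (C : ℝ))
  rw [Finset.mul_sum]
  exact Finset.sum_le_sum fun i _ => hg.dist_le_mul _ _

/-- A mean value inequality for absolutely continuous curves: if almost every velocity lies within
`ε` of a fixed vector `c`, then the displacement differs from the one with constant velocity `c` by
at most `ε` times the elapsed time. -/
theorem AbsolutelyContinuousOnInterval.norm_sub_sub_smul_le {φ : ℝ → E} {a b : ℝ}
    (hφ : AbsolutelyContinuousOnInterval φ a b) {c : E} {ε : ℝ}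
    (h : ∀ᵐ t : ℝ, t ∈ uIoo a b → ∃ v, HasDerivAt φ v t ∧ ‖v - c‖ ≤ ε) :
    ‖φ b - φ a - (b - a) • c‖ ≤ ε * |b - a| := by
  wlog hab : a ≤ b generalizing a b
  · have := this hφ.symm (by rwa [uIoo_comm]) (le_of_not_ge hab)
    rwa [abs_sub_comm, ← norm_neg,
      show -(φ b - φ a - (b - a) • c) = φ a - φ b - (a - b) • c by module]
  obtain ⟨g, hg1, hgw⟩ := exists_dual_vector'' ℝ (φ b - φ a - (b - a) • c)
  have hgw : g (φ b - φ a - (b - a) • c) = ‖φ b - φ a - (b - a) • c‖ := by simpa using hgw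
  have hac := g.lipschitz.comp_absolutelyContinuousOnInterval hφ
  have hint := hac.integral_deriv_eq_sub
  have hle : ∫ t in a..b, deriv (fun t => g (φ t)) t ≤ ∫ _t in a..b, (g c + ε) := by
    refine intervalIntegral.integral_mono_ae_restrict hab hac.intervalIntegrable_deriv
      intervalIntegrable_const ?_
    rw [← restrict_Ioo_eq_restrict_Icc]
    refine (ae_restrict_iff' measurableSet_Ioo).2 ?_
    filter_upwards [h] with t ht hts
    obtain ⟨v, hv, hvc⟩ := ht (by rwa [uIoo_of_le hab])
    have hd : HasDerivAt (fun t => g (φ t)) (g v) t := g.hasFDerivAt.comp_hasDerivAt t hv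
    have h1 : g (v - c) ≤ ε := (le_abs_self _).trans <| (g.le_opNorm (v - c)).trans <|
      (mul_le_of_le_one_left (norm_nonneg _) hg1).trans hvc
    rw [map_sub] at h1
    rw [hd.deriv]
    linarith
  rw [hint, intervalIntegral.integral_const, smul_eq_mul] at hle
  rw [← hgw, abs_of_nonneg (sub_nonneg.2 hab)]
  simp only [map_sub, map_smul, smul_eq_mul]
  nlinarith

/-- A localized Grönwall estimate: the velocity only needs to grow linearly where the
curve satisfies the a priori bound `‖φ t‖ ≤ R`, which the conclusion reproduces. The weak form, with
`l` larger than the growth rate `b`, suffices and allows a proof by continuous induction. -/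
theorem AbsolutelyContinuousOnInterval.one_add_norm_le_mul_exp {φ : ℝ → E} {s T b l R W : ℝ}
    (hsT : s ≤ T) (hφ : AbsolutelyContinuousOnInterval φ s T) (hb : 0 ≤ b) (hbl : b < l)
    (h : ∀ᵐ t : ℝ, t ∈ Ioo s T → ‖φ t‖ ≤ R →
      ∃ v, HasDerivAt φ v t ∧ ‖v‖ ≤ b * (1 + ‖φ t‖))
    (hW : 1 + ‖φ s‖ ≤ W) (hWR : W * Real.exp (l * (T - s)) < 1 + R) :
    ∀ t ∈ Icc s T, 1 + ‖φ t‖ ≤ W * Real.exp (l * (t - s)) := by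
  have hcont : ContinuousOn φ (Icc s T) := by simpa [uIcc_of_le hsT] using hφ.continuousOn
  have hW0 : 0 < W := by linarith [norm_nonneg (φ s)]
  have hl : 0 < l := hb.trans_lt hbl
  refine IsClosed.Icc_subset_of_forall_exists_gt
    (s := {t | 1 + ‖φ t‖ ≤ W * Real.exp (l * (t - s))}) ?_ (by simpa using hW) ?_
  · have := isClosed_Icc.isClosed_le (s := Icc s T) (f := fun t => 1 + ‖φ t‖)
      (g := fun t => W * Real.exp (l * (t - s))) (continuousOn_const.add hcont.norm) (by fun_prop)
    convert this using 1
    ext; simp [and_comm]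
  · rintro r ⟨hr : 1 + ‖φ r‖ ≤ _, hrs, hrT⟩ y hy
    have hw0 : 0 < 1 + ‖φ r‖ := by positivity
    have hlt : ‖φ r‖ < R := by
      have : W * Real.exp (l * (r - s)) ≤ W * Real.exp (l * (T - s)) := by gcongr
      linarith
    have hnear : ∀ᶠ t in 𝓝[Icc s T] r, ‖φ t‖ < R ∧ b * (1 + ‖φ t‖) < l * (1 + ‖φ r‖) := by
      have hc := (hcont r ⟨hrs, hrT.le⟩).norm
      refine (hc.eventually_lt_const hlt).and ?_
      refine (continuousWithinAt_const.mul
        (continuousWithinAt_const.add hc)).eventually_lt_const ?_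
      exact mul_lt_mul_of_pos_right hbl hw0
    have hnear' := nhdsWithin_le_of_mem (Icc_mem_nhdsGT_of_mem ⟨hrs, hrT⟩) hnear
    obtain ⟨z, hz, hzs⟩ := (mem_nhdsGT_iff_exists_Ioo_subset' hrT).1 hnear'
    set t := min ((r + z) / 2) (min y T) with ht
    have hzr : r < z := hz
    have hyr : r < y := hy
    have hrt : r < t := lt_min (by linarith) (lt_min hyr hrT)
    have htz : t < z := (min_le_left _ _).trans_lt (by linarith)
    have hty : t ≤ y := (min_le_right _ _).trans (min_le_left _ _)
    have htT : t ≤ T := (min_le_right _ _).trans (min_le_right _ _)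
    refine ⟨t, ?_, hrt, hty⟩
    have hmv := (hφ.mono (c := r) (d := t) (by
      rw [uIcc_of_le hrt.le, uIcc_of_le hsT]
      exact Icc_subset_Icc hrs htT)).norm_sub_sub_smul_le (c := 0) (ε := l * (1 + ‖φ r‖)) (by
      filter_upwards [h] with x hx hxm
      rw [uIoo_of_le hrt.le] at hxm
      obtain ⟨h1, h2⟩ := hzs ⟨hxm.1, hxm.2.trans htz⟩
      obtain ⟨v, hv, hvb⟩ := hx ⟨hrs.trans_lt hxm.1, hxm.2.trans_le htT⟩ h1.le
      exact ⟨v, hv, by simpa using hvb.trans h2.le⟩)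
    rw [smul_zero, sub_zero, abs_of_pos (sub_pos.2 hrt)] at hmv
    have h3 : ‖φ t‖ ≤ ‖φ r‖ + ‖φ t - φ r‖ := by
      simpa using norm_add_le (φ r) (φ t - φ r)
    have h4 : Real.exp (l * (t - s)) = Real.exp (l * (r - s)) * Real.exp (l * (t - r)) := by
      rw [← Real.exp_add]; ring_nf
    have h5 : l * (t - r) + 1 ≤ Real.exp (l * (t - r)) := Real.add_one_le_exp _
    calc 1 + ‖φ t‖ ≤ (1 + ‖φ r‖) * (l * (t - r) + 1) := by nlinarith
      _ ≤ (1 + ‖φ r‖) * Real.exp (l * (t - r)) := by gcongr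
      _ ≤ (W * Real.exp (l * (r - s))) * Real.exp (l * (t - r)) := by gcongr
      _ = W * Real.exp (l * (t - s)) := by rw [h4, mul_assoc]

/-! ### Hybrid time domains -/

namespace IsHybridTimeDomain

variable {D : Set (ℝ × ℕ)}

/-- The jump times of a hybrid time domain before `(T, J)`, in the form used for passing to limits.
The definition of a hybrid time domain does not exclude that the domain contains points `(s, k)`
with `k ≤ J` and `s > T`; this is why the upper bound in the last clause is on `min s T`. -/
theorem exists_jumpTimes (hD : IsHybridTimeDomain D) {T : ℝ} {J : ℕ} (h : (T, J) ∈ D) :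
    ∃ t : ℕ → ℝ, t 0 = 0 ∧ Monotone t ∧ (∀ j, J < j → t j = T) ∧
      (∀ s k, k ≤ J → t k ≤ s → s ≤ t (k + 1) → (s, k) ∈ D) ∧
      (∀ s k, k ≤ J → (s, k) ∈ D → t k ≤ s ∧ min s T ≤ t (k + 1)) := by
  have trunc : ∀ {T : ℝ} {J : ℕ}, (T, J) ∈ D → 0 ≤ T ∧ ∃ t : ℕ → ℝ, t 0 = 0 ∧ Monotone t ∧
      t (J + 1) = T ∧ ∀ s k, ((s, k) ∈ D ∧ 0 ≤ s ∧ s ≤ T ∧ k ≤ J) ↔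
        (k ≤ J ∧ t k ≤ s ∧ s ≤ t (k + 1)) := by
    intro T J h
    obtain ⟨J', t, h0, hm, he⟩ := hD.2 _ h
    have he' : ∀ s k, ((s, k) ∈ D ∧ (0 ≤ s ∧ s ≤ T) ∧ k ≤ J) ↔
        (k ≤ J' ∧ t k ≤ s ∧ s ≤ t (k + 1)) := by
      intro s k
      have := Set.ext_iff.1 he (s, k)
      simpa using this
    have h00 := (he' 0 0).2 ⟨Nat.zero_le _, h0.le, h0 ▸ hm (Nat.zero_le _)⟩
    have hT : 0 ≤ T := h00.2.1.2
    have h1 := (he' T J).1 ⟨h, ⟨hT, le_rfl⟩, le_rfl⟩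
    have h2 := (he' (t (J' + 1)) J').2 ⟨le_rfl, hm (Nat.le_succ _), le_rfl⟩
    obtain rfl : J' = J := le_antisymm h2.2.2 h1.1
    refine ⟨hT, t, h0, hm, le_antisymm h2.2.1.2 h1.2.2, fun s k => ?_⟩
    rw [← he', and_assoc]
  obtain ⟨hT, t, h0, hm, hJ, ht⟩ := trunc h
  have hle : ∀ j, j ≤ J + 1 → t j ≤ T := fun j hj => hJ ▸ hm hj
  have hmin : ∀ k, k ≤ J + 1 → t (min k (J + 1)) = t k := fun k hk => by rw [min_eq_left hk]
  refine ⟨fun j => t (min j (J + 1)), by simpa using h0,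
    fun i j hij => hm (min_le_min_right _ hij), fun j hj => by
      simp only; rw [min_eq_right (by omega), hJ], fun s k hk h1 h2 => ?_, fun s k hk hs => ?_⟩
  · simp only [hmin k (by omega)] at h1
    simp only [hmin (k + 1) (by omega)] at h2
    exact ((ht s k).2 ⟨hk, h1, h2⟩).1
  · simp only [hmin k (by omega), hmin (k + 1) (by omega)]
    have hs0 : 0 ≤ s := (trunc hs).1
    rcases le_or_gt s T with hsT | hsT
    · have := (ht s k).1 ⟨hs, hs0, hsT, hk⟩
      exact ⟨this.2.1, (min_le_left _ _).trans this.2.2⟩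
    · refine ⟨(hle k (by omega)).trans hsT.le, (min_le_right _ _).trans ?_⟩
      -- The slice at `k` reaches from `t (k + 1)` to `s`, hence contains `T`.
      obtain ⟨-, t', -, -, hk', ht'⟩ := trunc hs
      have h1 := ((ht (t (k + 1)) k).2 ⟨hk, hm (Nat.le_succ _), le_rfl⟩)
      have h2 := (ht' (t (k + 1)) k).1 ⟨h1.1, h1.2.1, h1.2.2.1.trans hsT.le, le_rfl⟩
      have h3 := (ht' T k).2 ⟨le_rfl, h2.2.1.trans h1.2.2.1, hk' ▸ hsT.le⟩
      exact ((ht T k).1 ⟨h3.1, hT, le_rfl, hk⟩).2.2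

theorem zero_mem (hD : IsHybridTimeDomain D) : (0, 0) ∈ D := by
  obtain ⟨⟨T, J⟩, h⟩ := hD.1
  obtain ⟨t, h0, hm, -, h1, -⟩ := hD.exists_jumpTimes h
  exact h1 0 0 (Nat.zero_le _) h0.le (h0 ▸ hm (Nat.zero_le _))

theorem nonneg (hD : IsHybridTimeDomain D) {T : ℝ} {J : ℕ} (h : (T, J) ∈ D) : 0 ≤ T := by
  obtain ⟨t, h0, hm, h1, -, -⟩ := hD.exists_jumpTimes h
  rw [← h1 (J + 1) (Nat.lt_succ_self _), ← h0]
  exact hm (Nat.zero_le _)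

theorem ordConnected (hD : IsHybridTimeDomain D) (j : ℕ) :
    OrdConnected {s : ℝ | (s, j) ∈ D} := by
  refine ⟨fun a ha b hb c hc => ?_⟩
  obtain ⟨t, h0, hm, h1, h2, h3⟩ := hD.exists_jumpTimes (T := b) hb
  exact h2 c j le_rfl ((h3 a j le_rfl ha).1.trans hc.1)
    (hc.2.trans (h1 (j + 1) (Nat.lt_succ_self _)).ge)

end IsHybridTimeDomain

/-! ### Solutions of perturbed systems -/

theorem HybridArc.absolutelyContinuousOnInterval (φ : HybridArc E) {a b : ℝ} {j : ℕ}
    (ha : (a, j) ∈ φ.dom) (hb : (b, j) ∈ φ.dom) :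
    AbsolutelyContinuousOnInterval (fun t => φ.val t j) a b := by
  wlog hab : a ≤ b generalizing a b
  · exact (this hb ha (le_of_not_ge hab)).symm
  exact φ.locallyAC j a b hab fun t ht =>
    (φ.isHybridTimeDomain.ordConnected j).out ha hb ht

namespace HybridSystem

variable {H : HybridSystem E} {f : E → E} {ρ : E → ℝ} {φ : HybridArc E}

theorem norm_sub_le_of_mem_perturb_F (hF : ∀ x, H.F x = {f x}) {x v c : E} {ε : ℝ}
    (h : ∀ y ∈ Metric.closedBall x (ρ x), ‖f y - c‖ ≤ ε) (hv : v ∈ (H.perturb ρ).F x) :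
    ‖v - c‖ ≤ ε + ρ x := by
  obtain ⟨w, hw, hvw⟩ := hv
  have hsub : closedConvexHull ℝ (⋃ y ∈ Metric.closedBall x (ρ x) ∩ H.C, H.F y) ⊆
      Metric.closedBall c ε := by
    refine closedConvexHull_min ?_ (convex_closedBall c ε) Metric.isClosed_closedBall
    refine iUnion₂_subset fun y hy => ?_
    rw [hF, singleton_subset_iff, mem_closedBall_iff_norm]
    exact h y hy.1
  have h1 := mem_closedBall_iff_norm.1 (hsub hw)
  have h2 := mem_closedBall_iff_norm.1 hvw
  calc ‖v - c‖ = ‖(w - c) + (v - w)‖ := by congr 1; abel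
    _ ≤ ε + ρ x := (norm_add_le _ _).trans (add_le_add h1 h2)

/-- Along a flow interval of a solution to a perturbed system, the displacement is that of the
constant velocity `c`, up to the deviation of the nominal velocities from `c` and the size of the
perturbation. -/
theorem IsSolution.norm_sub_sub_smul_le (hφ : (H.perturb ρ).IsSolution φ)
    (hF : ∀ x, H.F x = {f x}) {a b ε η : ℝ} {j : ℕ} {c : E} (ha : (a, j) ∈ φ.dom)
    (hb : (b, j) ∈ φ.dom)
    (hf : ∀ t ∈ uIcc a b, ∀ y ∈ Metric.closedBall (φ.val t j) (ρ (φ.val t j)), ‖f y - c‖ ≤ ε)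
    (hρ : ∀ t ∈ uIcc a b, ρ (φ.val t j) ≤ η) :
    ‖φ.val b j - φ.val a j - (b - a) • c‖ ≤ (ε + η) * |b - a| := by
  refine (φ.absolutelyContinuousOnInterval ha hb).norm_sub_sub_smul_le ?_
  filter_upwards [hφ.flow_deriv j] with t ht htab
  have htab' := uIoo_subset_uIcc_self htab
  obtain ⟨v, hv, hd⟩ := ht ((φ.isHybridTimeDomain.ordConnected j).uIcc_subset ha hb htab')
  exact ⟨v, hd, (norm_sub_le_of_mem_perturb_F hF (hf t htab') hv).trans
    (by linarith [hρ t htab'])⟩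

/-- If the flow map grows linearly and jumps increase the norm by a bounded amount, then solutions
to perturbations grow at most exponentially in hybrid time, as long as the perturbation is at most
`1` on the region that they can reach. -/
theorem IsSolution.one_add_norm_le_mul_exp (hφ : (H.perturb ρ).IsSolution φ)
    (hF : ∀ x, H.F x = {f x}) {a c R m : ℝ} (ha : 0 ≤ a) (hc : 0 ≤ c)
    (hfa : ∀ y, ‖f y‖ ≤ a * (1 + ‖y‖)) (hGc : ∀ y ∈ H.D, ∀ g ∈ H.G y, ‖g‖ ≤ ‖y‖ + c)
    (hρ : ∀ x, ‖x‖ ≤ R + 1 + c → ρ x ≤ 1)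
    (hR : (1 + ‖φ.val 0 0‖) * Real.exp ((2 * a + c + 2) * m) < 1 + R) {t : ℝ} {j : ℕ}
    (ht : (t, j) ∈ φ.dom) (htm : t + j ≤ m) :
    1 + ‖φ.val t j‖ ≤ (1 + ‖φ.val 0 0‖) * Real.exp ((2 * a + c + 2) * (t + j)) := by
  set l := 2 * a + c + 2 with hl
  have hl0 : 0 < l := by positivity
  set w₀ := 1 + ‖φ.val 0 0‖ with hw₀
  have hw₀pos : 0 < w₀ := by positivity
  have hlt : ∀ r : ℝ, r ≤ m → w₀ * Real.exp (l * r) < 1 + R := fun r hr =>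
    hR.trans_le' (by gcongr)
  induction j generalizing t with
  | zero =>
    have h00 := φ.isHybridTimeDomain.zero_mem
    have h0t := φ.isHybridTimeDomain.nonneg ht
    have := (φ.absolutelyContinuousOnInterval h00 ht).one_add_norm_le_mul_exp (b := 2 * a + 1)
      (l := l) (R := R) (W := w₀) h0t (by positivity) (by linarith) ?_ le_rfl
      (by simpa using hlt t (by simpa using htm)) t (right_mem_Icc.2 h0t)
    · simpa using this
    · exact flow_aux 0 h00 ht
  | succ j ih =>
    obtain ⟨τ, -, hmono, hτ, hmem, hle⟩ := φ.isHybridTimeDomain.exists_jumpTimes ht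
    have hst : τ (j + 1) ≤ t := (hle t (j + 1) le_rfl ht).1
    have hs1 : (τ (j + 1), j) ∈ φ.dom := hmem _ j (Nat.le_succ _) (hmono (Nat.le_succ _)) le_rfl
    have hs2 : (τ (j + 1), j + 1) ∈ φ.dom :=
      hmem _ (j + 1) le_rfl le_rfl (hmono (Nat.le_succ _))
    set s := τ (j + 1) with hs
    push_cast at htm
    have hw := ih hs1 (by linarith)
    have hxR : ‖φ.val s j‖ ≤ R := by linarith [hlt (s + j) (by linarith)]
    obtain ⟨-, y, ⟨hyx, hyD⟩, g, hg, hvg⟩ := hφ.jump s j hs1 hs2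
    have hy : ‖y‖ ≤ ‖φ.val s j‖ + 1 := by
      have h1 := mem_closedBall_iff_norm.1 hyx
      have h2 := hρ (φ.val s j) (by linarith)
      linarith [norm_le_norm_add_norm_sub' y (φ.val s j)]
    have hgn := hGc y hyD g hg
    have hv : ‖φ.val s (j + 1)‖ ≤ ‖g‖ + 1 := by
      have h1 := mem_closedBall_iff_norm.1 hvg
      have h2 := hρ g (by linarith)
      linarith [norm_le_norm_add_norm_sub' (φ.val s (j + 1)) g]
    have hW : 1 + ‖φ.val s (j + 1)‖ ≤ w₀ * Real.exp (l * (s + (j + 1))) := by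
      have he : Real.exp (l * (s + (j + 1))) = Real.exp (l * (s + j)) * Real.exp l := by
        rw [← Real.exp_add]; ring_nf
      calc 1 + ‖φ.val s (j + 1)‖ ≤ (1 + ‖φ.val s j‖) * (l + 1) := by
            nlinarith [norm_nonneg (φ.val s j)]
        _ ≤ (w₀ * Real.exp (l * (s + j))) * Real.exp l := by
            gcongr; exact Real.add_one_le_exp l
        _ = _ := by rw [he, mul_assoc]
    have he : ∀ r : ℝ, w₀ * Real.exp (l * (s + (j + 1))) * Real.exp (l * (r - s)) =
        w₀ * Real.exp (l * (r + (j + 1))) := by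
      intro r
      rw [mul_assoc, ← Real.exp_add]; ring_nf
    have := (φ.absolutelyContinuousOnInterval hs2 ht).one_add_norm_le_mul_exp (b := 2 * a + 1)
      (l := l) (R := R) hst (by positivity) (by linarith) (flow_aux (j + 1) hs2 ht) hW
      (by rw [he]; exact hlt _ (by linarith)) t (right_mem_Icc.2 hst)
    rw [he] at this
    push_cast
    exact this
where
  flow_aux (k : ℕ) {s t : ℝ} (hs : (s, k) ∈ φ.dom) (ht : (t, k) ∈ φ.dom) :
      ∀ᵐ r : ℝ, r ∈ Ioo s t → ‖φ.val r k‖ ≤ R →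
        ∃ v, HasDerivAt (fun r => φ.val r k) v r ∧ ‖v‖ ≤ (2 * a + 1) * (1 + ‖φ.val r k‖) := by
    filter_upwards [hφ.flow_deriv k] with r hr hrst hrR
    obtain ⟨v, hv, hd⟩ := hr ((φ.isHybridTimeDomain.ordConnected k).out hs ht
      (Ioo_subset_Icc_self hrst))
    have hρ1 := hρ (φ.val r k) (by linarith)
    refine ⟨v, hd, ?_⟩
    have := norm_sub_le_of_mem_perturb_F hF (c := 0) (ε := a * (2 + ‖φ.val r k‖))
      (fun y hy => ?_) hv
    · rw [sub_zero] at this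
      nlinarith [norm_nonneg (φ.val r k)]
    · rw [sub_zero]
      have h1 := mem_closedBall_iff_norm.1 hy
      refine (hfa y).trans (mul_le_mul_of_nonneg_left ?_ ha)
      linarith [norm_le_norm_add_norm_sub' y (φ.val r k)]

end HybridSystem

theorem eventually_forall_mul_le {X : Type*} [TopologicalSpace X] {ρ : X → ℝ} (hρ : Continuous ρ)
    {δ : ℕ → ℝ} (hδ0 : ∀ i, 0 ≤ δ i) (hδ : Tendsto δ atTop (𝓝 0)) {K : Set X} (hK : IsCompact K)
    {ε : ℝ} (hε : 0 < ε) : ∀ᶠ i in atTop, ∀ x ∈ K, δ i * ρ x ≤ ε := by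
  obtain ⟨B, hB⟩ := hK.exists_bound_of_continuousOn hρ.continuousOn
  have h : Tendsto (fun i => δ i * B) atTop (𝓝 0) := by simpa using hδ.mul_const B
  filter_upwards [h.eventually_le_const hε] with i hi x hx
  exact (mul_le_mul_of_nonneg_left ((le_abs_self _).trans (hB x hx)) (hδ0 i)).trans hi

namespace HybridSystem

/-- Under linear growth of the flow map and of the jump map there is no escape in finite hybrid
time, even in the limit of vanishing perturbations: however fast `ρ` grows, the perturbation is
eventually small on the bounded region reachable within a given hybrid time. -/
theorem locallyEventuallyBounded_of_linear_growth [ProperSpace E] {H : HybridSystem E} {f : E → E}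
    (hF : ∀ x, H.F x = {f x}) {a c : ℝ} (ha : 0 ≤ a) (hc : 0 ≤ c)
    (hfa : ∀ y, ‖f y‖ ≤ a * (1 + ‖y‖)) (hGc : ∀ y ∈ H.D, ∀ g ∈ H.G y, ‖g‖ ≤ ‖y‖ + c)
    {ρ : E → ℝ} (hρ : Continuous ρ) {δ : ℕ → ℝ} (hδ0 : ∀ i, 0 ≤ δ i)
    (hδ : Tendsto δ atTop (𝓝 0)) {φ : ℕ → HybridArc E} {x₀ : E}
    (hφ : ∀ i, (H.perturb (fun x => δ i * ρ x)).IsSolution (φ i))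
    (hx₀ : Tendsto (fun i => (φ i).val 0 0) atTop (𝓝 x₀)) : LocallyEventuallyBounded φ := by
  intro m
  -- The `2` leaves room for initial values up to distance `1` from `x₀`.
  set R := (2 + ‖x₀‖) * Real.exp ((2 * a + c + 2) * m) with hR
  refine ⟨Metric.closedBall 0 R, isCompact_closedBall _ _, ?_⟩
  filter_upwards [eventually_forall_mul_le hρ hδ0 hδ
      (isCompact_closedBall (0 : E) (R + 1 + c)) one_pos,
    hx₀.norm.eventually_lt_const (lt_add_one ‖x₀‖)] with i hi hi0 t j htj htm
  have hlt : (1 + ‖(φ i).val 0 0‖) * Real.exp ((2 * a + c + 2) * m) < 1 + R :=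
    (mul_le_mul_of_nonneg_right (by linarith) (Real.exp_nonneg _)).trans_lt (lt_one_add R)
  have := (hφ i).one_add_norm_le_mul_exp hF ha hc hfa hGc
    (fun x hx => hi x (by simpa using hx)) hlt htj htm.le
  have h2 : (1 + ‖(φ i).val 0 0‖) * Real.exp ((2 * a + c + 2) * (t + j)) ≤
      (1 + ‖(φ i).val 0 0‖) * Real.exp ((2 * a + c + 2) * m) := by gcongr
  rw [mem_closedBall_zero_iff]
  linarith

end HybridSystem

/-! ### Limits of sets and of hybrid time domains -/

theorem SetConverges.exists_tendsto {X : Type*} [PseudoMetricSpace X] {A : ℕ → Set X} {L : Set X}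
    (h : SetConverges A L) {x : X} (hx : x ∈ L) :
    ∃ y : ℕ → X, (∀ᶠ i in atTop, y i ∈ A i) ∧ Tendsto y atTop (𝓝 x) := by
  have hx' : ∀ U ∈ 𝓝 x, ∀ᶠ i in atTop, (A i ∩ U).Nonempty := by rw [← h.1] at hx; exact hx
  have hne : ∀ᶠ i in atTop, (A i).Nonempty :=
    (hx' univ univ_mem).mono fun i hi => hi.mono inter_subset_left
  have hy : ∀ i : ℕ, ∃ y, (A i).Nonempty →
      y ∈ A i ∧ dist x y < Metric.infDist x (A i) + 1 / ((i : ℝ) + 1) := by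
    intro i
    by_cases hi : (A i).Nonempty
    · obtain ⟨y, hy, hd⟩ := (Metric.infDist_lt_iff (x := x)
        (r := Metric.infDist x (A i) + 1 / ((i : ℝ) + 1)) hi).1
        (lt_add_of_pos_right _ Nat.one_div_pos_of_nat)
      exact ⟨y, fun _ => ⟨hy, hd⟩⟩
    · exact ⟨x, fun h => absurd h hi⟩
  choose y hy using hy
  refine ⟨y, hne.mono fun i hi => (hy i hi).1, Metric.tendsto_nhds.2 fun ε hε => ?_⟩
  filter_upwards [hne, hx' _ (Metric.ball_mem_nhds x (half_pos hε)),
    tendsto_one_div_add_atTop_nhds_zero_nat.eventually_lt_const (half_pos hε)] with i hi hi2 hi3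
  obtain ⟨z, hz, hzx⟩ := hi2
  have h1 : Metric.infDist x (A i) ≤ dist x z := Metric.infDist_le_dist_of_mem hz
  have h2 := (hy i hi).2
  rw [Metric.mem_ball, dist_comm] at hzx
  rw [dist_comm]
  linarith

theorem SetConverges.mem_of_tendsto {X : Type*} [TopologicalSpace X] {A : ℕ → Set X} {L : Set X}
    (h : SetConverges A L) {l : Filter ℕ} [l.NeBot] (hl : l ≤ atTop) {y : ℕ → X} {x : X}
    (hy : ∀ᶠ i in l, y i ∈ A i) (hyx : Tendsto y l (𝓝 x)) : x ∈ L := by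
  rw [← h.2]
  intro U hU
  have h1 : ∀ᶠ i in l, (A i ∩ U).Nonempty := by
    filter_upwards [hy, hyx hU] with i h1 h2 using ⟨y i, h1, h2⟩
  exact h1.frequently.filter_mono hl

theorem IsCompact.exists_tendsto_of_ultrafilter {X : Type*} [TopologicalSpace X] {K : Set X}
    (hK : IsCompact K) (𝒰 : Ultrafilter ℕ) {y : ℕ → X} (hy : ∀ᶠ i in 𝒰, y i ∈ K) :
    ∃ x ∈ K, Tendsto y 𝒰 (𝓝 x) :=
  hK.ultrafilter_le_nhds' (𝒰.map y) hy

/-- A sequence of hybrid arcs is locally eventually Lipschitz if for each `m` the arcs restricted to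
`t + j < m` eventually share a Lipschitz constant with respect to `t`. -/
def LocallyEventuallyLipschitz (φ : ℕ → HybridArc E) : Prop :=
  ∀ m : ℝ, ∃ L : ℝ, 0 ≤ L ∧ ∀ᶠ i in atTop, ∀ (j : ℕ) (a b : ℝ), (a, j) ∈ (φ i).dom →
    (b, j) ∈ (φ i).dom → a + j < m → b + j < m →
      ‖(φ i).val b j - (φ i).val a j‖ ≤ L * |b - a|

section GraphicalLimit

variable {φ : ℕ → HybridArc E} {M : Set (ℝ × ℕ × E)}

theorem exists_tendsto_of_mem_graphicalLimit (hM : SetConverges (fun i => (φ i).graph) M) {t : ℝ}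
    {j : ℕ} {z : E} (h : (t, j, z) ∈ M) :
    ∃ s : ℕ → ℝ, (∀ᶠ i in atTop, (s i, j) ∈ (φ i).dom) ∧ Tendsto s atTop (𝓝 t) ∧
      Tendsto (fun i => (φ i).val (s i) j) atTop (𝓝 z) := by
  obtain ⟨y, hy, hyt⟩ := hM.exists_tendsto h
  have h1 : Tendsto (fun i => (y i).1) atTop (𝓝 t) := (continuous_fst.tendsto _).comp hyt
  have h2 : Tendsto (fun i => (y i).2.1) atTop (𝓝 j) :=
    ((continuous_fst.comp continuous_snd).tendsto _).comp hyt
  have h3 : Tendsto (fun i => (y i).2.2) atTop (𝓝 z) :=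
    ((continuous_snd.comp continuous_snd).tendsto _).comp hyt
  rw [nhds_discrete, tendsto_pure] at h2
  refine ⟨fun i => (y i).1, ?_, h1, h3.congr' ?_⟩
  · filter_upwards [hy, h2] with i hi hj
    have := hi.1
    rwa [hj] at this
  · filter_upwards [hy, h2] with i hi hj
    have := hi.2
    rwa [hj] at this

theorem exists_mem_graphicalLimit (hM : SetConverges (fun i => (φ i).graph) M)
    (hb : LocallyEventuallyBounded φ) {𝒰 : Ultrafilter ℕ} (h𝒰 : (𝒰 : Filter ℕ) ≤ atTop) {t : ℝ}
    {j : ℕ} {s : ℕ → ℝ} (hs : ∀ᶠ i in 𝒰, (s i, j) ∈ (φ i).dom) (hst : Tendsto s 𝒰 (𝓝 t)) :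
    ∃ z, (t, j, z) ∈ M := by
  obtain ⟨K, hK, hKi⟩ := hb (t + j + 1)
  obtain ⟨z, -, hz⟩ := hK.exists_tendsto_of_ultrafilter 𝒰
    (y := fun i => (φ i).val (s i) j) (by
      filter_upwards [h𝒰 hKi, hs, hst.eventually_lt_const (lt_add_one t)] with i h1 h2 h3
      exact h1 _ _ h2 (by linarith))
  refine ⟨z, hM.mem_of_tendsto h𝒰 (y := fun i => (s i, j, (φ i).val (s i) j)) ?_
    (hst.prodMk_nhds (tendsto_const_nhds.prodMk_nhds hz))⟩
  filter_upwards [hs] with i hi using ⟨hi, rfl⟩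

theorem tendsto_val_of_mem_graphicalLimit (hM : SetConverges (fun i => (φ i).graph) M)
    (hL : LocallyEventuallyLipschitz φ) {t : ℝ} {j : ℕ} {z : E} (h : (t, j, z) ∈ M)
    {l : Filter ℕ} (hl : l ≤ atTop) {s : ℕ → ℝ} (hs : ∀ᶠ i in l, (s i, j) ∈ (φ i).dom)
    (hst : Tendsto s l (𝓝 t)) : Tendsto (fun i => (φ i).val (s i) j) l (𝓝 z) := by
  obtain ⟨r, hr, hrt, hrz⟩ := exists_tendsto_of_mem_graphicalLimit hM h
  obtain ⟨L, -, hLi⟩ := hL (t + j + 1)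
  have h0 : Tendsto (fun i => L * |s i - r i|) l (𝓝 0) := by
    simpa using ((hst.sub (hrt.mono_left hl)).abs).const_mul L
  have h1 : Tendsto (fun i => (φ i).val (s i) j - (φ i).val (r i) j) l (𝓝 0) := by
    refine squeeze_zero_norm' ?_ h0
    filter_upwards [hl hLi, hs, hl hr, hst.eventually_lt_const (lt_add_one t),
      (hrt.mono_left hl).eventually_lt_const (lt_add_one t)] with i h1 h2 h3 h4 h5
    exact h1 j _ _ h3 h2 (by linarith) (by linarith)
  simpa using h1.add (hrz.mono_left hl)

/-- The hybrid time domains of a locally eventually bounded, graphically convergent sequence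
converge to a hybrid time domain: the jump times converge along an ultrafilter. -/
theorem isHybridTimeDomain_graphicalLimit (hM : SetConverges (fun i => (φ i).graph) M)
    (hb : LocallyEventuallyBounded φ) (hne : M.Nonempty) :
    IsHybridTimeDomain {p : ℝ × ℕ | ∃ z, (p.1, p.2, z) ∈ M} := by
  refine ⟨hne.elim fun p hp => ⟨(p.1, p.2.1), p.2.2, hp⟩, ?_⟩
  rintro ⟨T, J⟩ ⟨z, hz⟩
  obtain ⟨s, hs, hsT, -⟩ := exists_tendsto_of_mem_graphicalLimit hM hz
  obtain ⟨𝒰, h𝒰⟩ : ∃ 𝒰 : Ultrafilter ℕ, (𝒰 : Filter ℕ) ≤ atTop :=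
    ⟨hyperfilter ℕ, Nat.hyperfilter_le_atTop⟩
  have hτ := fun i (h : (s i, J) ∈ (φ i).dom) => (φ i).isHybridTimeDomain.exists_jumpTimes h
  choose! τ hτ using hτ
  have hs' : ∀ᶠ i in 𝒰, (s i, J) ∈ (φ i).dom := h𝒰 hs
  have hsT' := hsT.mono_left h𝒰
  have hlim : ∀ j, ∃ x ∈ Icc 0 (T + 1), Tendsto (fun i => τ i j) 𝒰 (𝓝 x) := by
    intro j
    refine isCompact_Icc.exists_tendsto_of_ultrafilter 𝒰 ?_
    filter_upwards [hs', hsT'.eventually_lt_const (lt_add_one T)] with i hi hiT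
    obtain ⟨h0, hm, hJ, -, -⟩ := hτ i hi
    refine ⟨h0 ▸ hm (Nat.zero_le j), (hm (le_max_left j (J + 1))).trans ?_⟩
    rw [hJ _ (lt_max_of_lt_right (Nat.lt_succ_self J))]
    exact hiT.le
  choose t _ ht using hlim
  have ht0 : t 0 = 0 := tendsto_nhds_unique_of_eventuallyEq (ht 0) tendsto_const_nhds
    (hs'.mono fun i hi => (hτ i hi).1)
  have htm : Monotone t := fun j k hjk => le_of_tendsto_of_tendsto (ht j) (ht k)
    (hs'.mono fun i hi => (hτ i hi).2.1 hjk)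
  have htJ : t (J + 1) = T := tendsto_nhds_unique_of_eventuallyEq (ht _) hsT'
    (hs'.mono fun i hi => (hτ i hi).2.2.1 _ (Nat.lt_succ_self J))
  refine ⟨J, t, ht0, htm, ?_⟩
  ext ⟨r, k⟩
  simp only [mem_inter_iff, mem_ofPred_eq, mem_prod, mem_Icc, mem_Iic]
  constructor
  · rintro ⟨⟨y, hy⟩, ⟨-, hrT⟩, hkJ⟩
    obtain ⟨r', hr', hrr, -⟩ := exists_tendsto_of_mem_graphicalLimit hM hy
    have hrr' := hrr.mono_left h𝒰
    have h5 : ∀ᶠ i in 𝒰, τ i k ≤ r' i ∧ min (r' i) (s i) ≤ τ i (k + 1) := by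
      filter_upwards [hs', h𝒰 hr'] with i hi hri
      exact (hτ i hi).2.2.2.2 _ k hkJ hri
    refine ⟨hkJ, le_of_tendsto_of_tendsto (ht k) hrr' (h5.mono fun i hi => hi.1), ?_⟩
    rw [← min_eq_left hrT]
    exact le_of_tendsto_of_tendsto (hrr'.min hsT') (ht (k + 1)) (h5.mono fun i hi => hi.2)
  · rintro ⟨hkJ, h1, h2⟩
    refine ⟨?_, ⟨(ht0 ▸ htm (Nat.zero_le k)).trans h1, h2.trans (htJ ▸ htm (by omega))⟩, hkJ⟩
    refine exists_mem_graphicalLimit hM hb h𝒰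
      (s := fun i => max (τ i k) (min r (τ i (k + 1)))) ?_ ?_
    · filter_upwards [hs'] with i hi
      obtain ⟨-, hm, -, hmem, -⟩ := hτ i hi
      exact hmem _ k hkJ (le_max_left _ _) (max_le (hm (Nat.le_succ k)) (min_le_right _ _))
    · have := (ht k).max ((tendsto_const_nhds (x := r)).min (ht (k + 1)))
      rwa [min_eq_left h2, max_eq_right h1] at this

/-- Equi-Lipschitz arcs have a single-valued graphical limit, which is again a hybrid arc. -/
theorem exists_hybridArc_graph_eq (hM : SetConverges (fun i => (φ i).graph) M)
    (hb : LocallyEventuallyBounded φ) (hL : LocallyEventuallyLipschitz φ) (hne : M.Nonempty) :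
    ∃ ψ : HybridArc E, ψ.graph = M := by
  classical
  set val : ℝ → ℕ → E := fun t j => if h : ∃ z, (t, j, z) ∈ M then h.choose else 0 with hval
  have hmem : ∀ t j, (∃ z, (t, j, z) ∈ M) → (t, j, val t j) ∈ M := by
    intro t j h
    simp only [hval, dif_pos h]
    exact h.choose_spec
  refine ⟨⟨{p | ∃ z, (p.1, p.2, z) ∈ M}, val, isHybridTimeDomain_graphicalLimit hM hb hne, ?_⟩, ?_⟩
  · intro j a b hab h
    obtain ⟨L, hL0, hLi⟩ := hL (b + j + 1)
    refine LipschitzOnWith.absolutelyContinuousOnInterval (K := L.toNNReal) ?_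
    rw [uIcc_of_le hab]
    refine LipschitzOnWith.of_dist_le_mul fun x hx y hy => ?_
    rw [Real.coe_toNNReal _ hL0, dist_eq_norm, Real.dist_eq]
    obtain ⟨r, hr, hrx, hrz⟩ := exists_tendsto_of_mem_graphicalLimit hM (hmem x j (h x hx))
    obtain ⟨s, hs, hsy, hsz⟩ := exists_tendsto_of_mem_graphicalLimit hM (hmem y j (h y hy))
    refine le_of_tendsto_of_tendsto (hrz.sub hsz).norm ((hrx.sub hsy).abs.const_mul L) ?_
    filter_upwards [hr, hs, hLi, hrx.eventually_lt_const (hx.2.trans_lt (lt_add_one b)),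
      hsy.eventually_lt_const (hy.2.trans_lt (lt_add_one b))] with i h1 h2 h3 h4 h5
    exact h3 j _ _ h2 h1 (by linarith) (by linarith)
  · ext ⟨t, j, z⟩
    constructor
    · rintro ⟨h1, h2⟩
      simp only at h2
      rw [h2]
      exact hmem t j h1
    · intro h
      refine ⟨⟨z, h⟩, ?_⟩
      obtain ⟨s, hs, hst, hsz⟩ := exists_tendsto_of_mem_graphicalLimit hM h
      exact tendsto_nhds_unique hsz
        (tendsto_val_of_mem_graphicalLimit hM hL (hmem t j ⟨z, h⟩) le_rfl hs hst)

end GraphicalLimit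

/-! ### Graphical limits of solutions to perturbed systems -/

/-- If points `x i` converge and lie within vanishing distance of a closed set, their limit lies in
that set. -/
theorem IsClosed.mem_of_closedBall_inter_nonempty {X : Type*} [PseudoMetricSpace X] {S : Set X}
    (hS : IsClosed S) {ι : Type*} {l : Filter ι} [l.NeBot] {x : ι → X} {r : ι → ℝ} {z : X}
    (h : ∀ᶠ i in l, (Metric.closedBall (x i) (r i) ∩ S).Nonempty) (hx : Tendsto x l (𝓝 z))
    (hr : Tendsto r l (𝓝 0)) : z ∈ S := by
  obtain ⟨y, hy⟩ := h.choice
  refine hS.mem_of_tendsto ?_ (hy.mono fun i hi => hi.2)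
  refine tendsto_of_tendsto_of_dist hx
    (squeeze_zero' (Eventually.of_forall fun _ => dist_nonneg) ?_ hr)
  filter_upwards [hy] with i hi
  rw [dist_comm]
  exact hi.1

namespace HybridSystem

variable {H : HybridSystem E} {f : E → E} {ρ : E → ℝ} {δ : ℕ → ℝ} {φ : ℕ → HybridArc E}
  {M : Set (ℝ × ℕ × E)}

theorem locallyEventuallyLipschitz [ProperSpace E] (hF : ∀ x, H.F x = {f x}) (hf : Continuous f)
    (hρ : Continuous ρ) (hδ0 : ∀ i, 0 ≤ δ i) (hδ : Tendsto δ atTop (𝓝 0))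
    (hφ : ∀ i, (H.perturb (fun x => δ i * ρ x)).IsSolution (φ i))
    (hb : LocallyEventuallyBounded φ) : LocallyEventuallyLipschitz φ := by
  intro m
  obtain ⟨K, hK, hKi⟩ := hb m
  obtain ⟨B, hB⟩ := (hK.cthickening (r := 1)).exists_bound_of_continuousOn hf.continuousOn
  refine ⟨max B 0 + 1, by positivity, ?_⟩
  filter_upwards [hKi, eventually_forall_mul_le hρ hδ0 hδ hK one_pos]
    with i h1 h2 j a b ha hb ham hbm
  have hmem : ∀ t ∈ uIcc a b, (φ i).val t j ∈ K := fun t ht =>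
    h1 t j (((φ i).isHybridTimeDomain.ordConnected j).uIcc_subset ha hb ht) (by
      rcases le_total a b with h | h
      · rw [uIcc_of_le h] at ht; linarith [ht.2]
      · rw [uIcc_of_ge h] at ht; linarith [ht.2])
  have := (hφ i).norm_sub_sub_smul_le hF (c := 0) (ε := max B 0) (η := 1) ha hb
    (fun t ht y hy => ?_) (fun t ht => h2 _ (hmem t ht))
  · simpa using this
  · rw [sub_zero]
    refine (hB y (Metric.mem_cthickening_of_dist_le y _ 1 K (hmem t ht) ?_)).trans (le_max_left _ _)
    exact (Metric.mem_closedBall.1 hy).trans (h2 _ (hmem t ht))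

section Limit

variable {ψ : HybridArc E}

theorem exists_Icc_subset_of_mem_interior {S : Set ℝ} {t : ℝ} (ht : t ∈ interior S) :
    ∃ a b, a < t ∧ t < b ∧ Icc a b ⊆ S := by
  obtain ⟨ε, hε, h⟩ := Metric.nhds_basis_closedBall.mem_iff.1 (mem_interior_iff_mem_nhds.1 ht)
  rw [Real.closedBall_eq_Icc] at h
  exact ⟨t - ε, t + ε, by linarith, by linarith, h⟩

theorem _root_.HybridArc.mem_graph_iff (ψ : HybridArc E) {t : ℝ} {j : ℕ} {z : E} :
    (t, j, z) ∈ ψ.graph ↔ (t, j) ∈ ψ.dom ∧ z = ψ.val t j := Iff.rfl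

theorem tendsto_val (hM : SetConverges (fun i => (φ i).graph) ψ.graph)
    (hL : LocallyEventuallyLipschitz φ) {t : ℝ} {j : ℕ} (h : (t, j) ∈ ψ.dom)
    {s : ℕ → ℝ} (hs : ∀ᶠ i in atTop, (s i, j) ∈ (φ i).dom) (hst : Tendsto s atTop (𝓝 t)) :
    Tendsto (fun i => (φ i).val (s i) j) atTop (𝓝 (ψ.val t j)) :=
  tendsto_val_of_mem_graphicalLimit hM hL (ψ.mem_graph_iff.2 ⟨h, rfl⟩) le_rfl hs hst

theorem eventually_mem_interior (hM : SetConverges (fun i => (φ i).graph) ψ.graph) {t : ℝ} {j : ℕ}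
    (ht : t ∈ interior {s : ℝ | (s, j) ∈ ψ.dom}) :
    ∀ᶠ i in atTop, t ∈ interior {s : ℝ | (s, j) ∈ (φ i).dom} := by
  obtain ⟨a, b, hat, htb, hab⟩ := exists_Icc_subset_of_mem_interior ht
  have hab' : a ≤ b := (hat.trans htb).le
  obtain ⟨r, hr, hra, -⟩ := exists_tendsto_of_mem_graphicalLimit hM
    (ψ.mem_graph_iff.2 ⟨hab (left_mem_Icc.2 hab'), rfl⟩)
  obtain ⟨s, hs, hsb, -⟩ := exists_tendsto_of_mem_graphicalLimit hM
    (ψ.mem_graph_iff.2 ⟨hab (right_mem_Icc.2 hab'), rfl⟩)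
  filter_upwards [hr, hs, hra.eventually_lt_const hat, hsb.eventually_const_lt htb]
    with i h1 h2 h3 h4
  exact mem_interior_iff_mem_nhds.2 (mem_of_superset (Icc_mem_nhds h3 h4)
    (((φ i).isHybridTimeDomain.ordConnected j).out h1 h2))

/-- At a point in the interior of a flow interval, the graphical limit has the nominal velocity:
near that point the velocities of the approximating solutions eventually are close to it. -/
theorem hasDerivAt_graphicalLimit [ProperSpace E] (hF : ∀ x, H.F x = {f x}) (hf : Continuous f)
    (hρ : Continuous ρ) (hδ0 : ∀ i, 0 ≤ δ i) (hδ : Tendsto δ atTop (𝓝 0))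
    (hφ : ∀ i, (H.perturb (fun x => δ i * ρ x)).IsSolution (φ i))
    (hM : SetConverges (fun i => (φ i).graph) ψ.graph) (hL : LocallyEventuallyLipschitz φ)
    {t : ℝ} {j : ℕ} (ht : t ∈ interior {s : ℝ | (s, j) ∈ ψ.dom}) :
    HasDerivAt (fun s => ψ.val s j) (f (ψ.val t j)) t := by
  rw [hasDerivAt_iff_isLittleO, Asymptotics.isLittleO_iff]
  intro ε hε
  set x := ψ.val t j with hx
  obtain ⟨η, hη, hηf⟩ := Metric.continuousAt_iff.1 hf.continuousAt (ε / 2) (half_pos hε)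
  obtain ⟨L, hL0, hLi⟩ := hL (t + 1 + j)
  -- Within time `κ` of `t`, the Lipschitz bound keeps the arcs within `η / 4` of their
  -- value at `t`.
  set κ := min 1 (η / (4 * (L + 1))) with hκ
  have hκ0 : 0 < κ := lt_min one_pos (by positivity)
  have hκL : L * κ ≤ η / 4 := by
    have : κ * (4 * (L + 1)) ≤ η := by
      rw [← le_div_iff₀ (by positivity)]; exact min_le_right _ _
    nlinarith
  filter_upwards [isOpen_interior.mem_nhds ht, Metric.ball_mem_nhds t hκ0] with s hs hst
  rw [Metric.mem_ball, Real.dist_eq] at hst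
  have htd := interior_subset ht
  have hsd := interior_subset hs
  have hti := (eventually_mem_interior hM ht).mono fun i hi => interior_subset hi
  have hsi := (eventually_mem_interior hM hs).mono fun i hi => interior_subset hi
  have hφt := tendsto_val hM hL htd hti tendsto_const_nhds
  have hφs := tendsto_val hM hL hsd hsi tendsto_const_nhds
  refine le_of_tendsto ((hφs.sub hφt).sub_const _).norm ?_
  have hmin : 0 < min (η / 4) (ε / 2) := by positivity
  filter_upwards [hti, hsi, hLi, Metric.tendsto_nhds.1 hφt (η / 4) (by positivity),
    eventually_forall_mul_le hρ hδ0 hδ (isCompact_closedBall x η) hmin] with i h1 h2 h3 h4 h5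
  rw [Real.norm_eq_abs]
  have hclose : ∀ r ∈ uIcc t s, dist ((φ i).val r j) x ≤ η / 2 := by
    intro r hr
    have hrt : |r - t| ≤ |s - t| := by
      simpa [abs_sub_comm] using abs_sub_left_of_mem_uIcc hr
    have hlt : ∀ r : ℝ, |r - t| < κ → r + j < t + 1 + j := fun r hr => by
      have := (le_abs_self _).trans_lt (hr.trans_le (min_le_left _ _)); linarith
    have h6 := h3 j t r h1 (((φ i).isHybridTimeDomain.ordConnected j).uIcc_subset h1 h2 hr)
      (hlt t (by simpa using hκ0)) (hlt r (hrt.trans_lt hst))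
    rw [← dist_eq_norm] at h6
    have h7 : L * |r - t| ≤ L * κ := mul_le_mul_of_nonneg_left (hrt.trans hst.le) hL0
    linarith [dist_triangle ((φ i).val r j) ((φ i).val t j) x]
  have hsmall : ∀ r ∈ uIcc t s, δ i * ρ ((φ i).val r j) ≤ min (η / 4) (ε / 2) := fun r hr =>
    h5 _ (Metric.mem_closedBall.2 ((hclose r hr).trans (by linarith)))
  have := (hφ i).norm_sub_sub_smul_le hF (c := f x) (ε := ε / 2) (η := ε / 2) h1 h2
    (fun r hr y hy => ?_) (fun r hr => (hsmall r hr).trans (min_le_right _ _))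
  · simpa using this
  · have hyx : dist y x < η := by
      have h6 := hclose r hr
      have h7 := (Metric.mem_closedBall.1 hy).trans ((hsmall r hr).trans (min_le_left _ _))
      linarith [dist_triangle y ((φ i).val r j) x]
    rw [← dist_eq_norm]
    exact (hηf hyx).le

/-- Jumps of the graphical limit are limits of jumps of the approximating solutions. -/
theorem exists_tendsto_jump (hM : SetConverges (fun i => (φ i).graph) ψ.graph)
    (hL : LocallyEventuallyLipschitz φ) {t : ℝ} {j : ℕ} (h1 : (t, j) ∈ ψ.dom)
    (h2 : (t, j + 1) ∈ ψ.dom) :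
    ∃ s : ℕ → ℝ, (∀ᶠ i in atTop, (s i, j) ∈ (φ i).dom ∧ (s i, j + 1) ∈ (φ i).dom) ∧
      Tendsto (fun i => (φ i).val (s i) j) atTop (𝓝 (ψ.val t j)) ∧
      Tendsto (fun i => (φ i).val (s i) (j + 1)) atTop (𝓝 (ψ.val t (j + 1))) := by
  obtain ⟨a, ha, hat, -⟩ := exists_tendsto_of_mem_graphicalLimit hM
    (ψ.mem_graph_iff.2 ⟨h1, rfl⟩)
  obtain ⟨b, hb, hbt, -⟩ := exists_tendsto_of_mem_graphicalLimit hM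
    (ψ.mem_graph_iff.2 ⟨h2, rfl⟩)
  have key : ∀ i, ∃ s, (a i, j) ∈ (φ i).dom → (b i, j + 1) ∈ (φ i).dom →
      ((s, j) ∈ (φ i).dom ∧ (s, j + 1) ∈ (φ i).dom) ∧ min (a i) (b i) ≤ s ∧ s ≤ b i := by
    intro i
    by_cases hbi : (b i, j + 1) ∈ (φ i).dom
    · obtain ⟨τ, -, hm, -, hmem, hle⟩ := (φ i).isHybridTimeDomain.exists_jumpTimes hbi
      exact ⟨τ (j + 1), fun hai _ => ⟨⟨hmem _ j (Nat.le_succ j) (hm (Nat.le_succ j)) le_rfl,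
        hmem _ (j + 1) le_rfl le_rfl (hm (Nat.le_succ _))⟩,
        (hle _ j (Nat.le_succ j) hai).2, (hle _ (j + 1) le_rfl hbi).1⟩⟩
    · exact ⟨0, fun _ h => absurd h hbi⟩
  choose s hs using key
  have hs' : ∀ᶠ i in atTop, ((s i, j) ∈ (φ i).dom ∧ (s i, j + 1) ∈ (φ i).dom) ∧
      min (a i) (b i) ≤ s i ∧ s i ≤ b i := by
    filter_upwards [ha, hb] with i hai hbi using hs i hai hbi
  have hst : Tendsto s atTop (𝓝 t) := by
    refine tendsto_of_tendsto_of_tendsto_of_le_of_le' (by simpa using hat.min hbt) hbt ?_ ?_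
    · exact hs'.mono fun i hi => hi.2.1
    · exact hs'.mono fun i hi => hi.2.2
  exact ⟨s, hs'.mono fun i hi => hi.1, tendsto_val hM hL h1 (hs'.mono fun i hi => hi.1.1) hst,
    tendsto_val hM hL h2 (hs'.mono fun i hi => hi.1.2) hst⟩

/-- Perturbed jumps converge to nominal jumps. -/
theorem mem_jump_of_tendsto [ProperSpace E] (hD : IsClosed H.D) (hG : OuterSemicontOn H.G H.D)
    (hGb : LocallyBoundedOn H.G H.D) (hρ : Continuous ρ) (hδ0 : ∀ i, 0 ≤ δ i)
    (hδ : Tendsto δ atTop (𝓝 0)) {x v : ℕ → E} {z w : E}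
    (hv : ∀ᶠ i in atTop, v i ∈ (H.perturb (fun x => δ i * ρ x)).G (x i))
    (hx : Tendsto x atTop (𝓝 z)) (hvw : Tendsto v atTop (𝓝 w)) : z ∈ H.D ∧ w ∈ H.G z := by
  have hρx : Tendsto (fun i => δ i * ρ (x i)) atTop (𝓝 0) := by
    simpa using hδ.mul ((hρ.tendsto z).comp hx)
  have hz : z ∈ H.D := hD.mem_of_closedBall_inter_nonempty
    (hv.mono fun i ⟨y, hy, _⟩ => ⟨y, hy⟩) hx hρx
  refine ⟨hz, ?_⟩
  obtain ⟨N, hN⟩ := eventually_atTop.1 hv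
  choose! y hy g hg hvg using hN
  have hyz : Tendsto y atTop (𝓝 z) := by
    refine tendsto_of_tendsto_of_dist hx
      (squeeze_zero' (Eventually.of_forall fun _ => dist_nonneg) ?_ hρx)
    filter_upwards [eventually_ge_atTop N] with i hi
    rw [dist_comm]
    exact (hy i hi).1
  obtain ⟨U, hU, hUb⟩ := hGb z hz
  obtain ⟨R, hR⟩ := hUb.subset_closedBall 0
  have hgR : ∀ᶠ i in atTop, g i ∈ Metric.closedBall (0 : E) R := by
    filter_upwards [eventually_ge_atTop N, hyz hU] with i hi hiU
    exact hR (mem_iUnion₂.2 ⟨y i, ⟨hiU, (hy i hi).2⟩, hg i hi⟩)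
  have hgw : Tendsto g atTop (𝓝 w) := by
    refine tendsto_of_tendsto_of_dist hvw (Metric.tendsto_nhds.2 fun ε hε => ?_)
    filter_upwards [eventually_ge_atTop N, hgR,
      eventually_forall_mul_le hρ hδ0 hδ (isCompact_closedBall (0 : E) R) (half_pos hε)]
      with i hi h1 h2
    rw [Real.dist_eq, sub_zero, abs_of_nonneg dist_nonneg]
    have := (Metric.mem_closedBall.1 (hvg i hi)).trans (h2 _ h1)
    linarith
  exact hG z hz w (fun i => y (i + N)) (fun i => g (i + N))
    (fun i => (hy _ (Nat.le_add_left _ _)).2) (fun i => hg _ (Nat.le_add_left _ _))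
    ((tendsto_add_atTop_iff_nat N).2 hyz) ((tendsto_add_atTop_iff_nat N).2 hgw)

theorem isSolution_graphicalLimit [ProperSpace E] (hC : IsClosed H.C) (hD : IsClosed H.D)
    (hF : ∀ x, H.F x = {f x}) (hf : Continuous f) (hG : OuterSemicontOn H.G H.D)
    (hGb : LocallyBoundedOn H.G H.D)
    (hρ : Continuous ρ) (hδ0 : ∀ i, 0 ≤ δ i) (hδ : Tendsto δ atTop (𝓝 0))
    (hφ : ∀ i, (H.perturb (fun x => δ i * ρ x)).IsSolution (φ i))
    (hM : SetConverges (fun i => (φ i).graph) ψ.graph) (hL : LocallyEventuallyLipschitz φ) :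
    H.IsSolution ψ := by
  have hρt : ∀ {x : ℕ → E} {z : E}, Tendsto x atTop (𝓝 z) →
      Tendsto (fun i => δ i * ρ (x i)) atTop (𝓝 0) := fun hx => by
    simpa using hδ.mul ((hρ.tendsto _).comp hx)
  refine ⟨?_, fun j t ht => ?_, fun j => ?_, fun t j h1 h2 => ?_⟩
  · have hx₀ : Tendsto (fun i => (φ i).val 0 0) atTop (𝓝 (ψ.val 0 0)) :=
      tendsto_val hM hL ψ.isHybridTimeDomain.zero_mem
        (Eventually.of_forall fun i => (φ i).isHybridTimeDomain.zero_mem) tendsto_const_nhds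
    rw [hC.closure_eq]
    -- Initial values in the closure of a perturbed flow set are close to that set itself.
    have hnear : ∀ i, ∃ y, dist ((φ i).val 0 0) y < 1 / ((i : ℝ) + 1) ∧
        (Metric.closedBall y (δ i * ρ y) ∩ (H.C ∪ H.D)).Nonempty := by
      intro i
      rcases (hφ i).init with h | h
      · obtain ⟨y, hy, hd⟩ := Metric.mem_closure_iff.1 h _
          (Nat.one_div_pos_of_nat (α := ℝ) (n := i))
        exact ⟨y, hd, hy.mono (inter_subset_inter_right _ subset_union_left)⟩
      · exact ⟨_, by simpa using (Nat.one_div_pos_of_nat (α := ℝ) (n := i)),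
          h.mono (inter_subset_inter_right _ subset_union_right)⟩
    choose y hy hyn using hnear
    have hyt : Tendsto y atTop (𝓝 (ψ.val 0 0)) :=
      tendsto_of_tendsto_of_dist hx₀ (squeeze_zero (fun _ => dist_nonneg)
        (fun i => (hy i).le) tendsto_one_div_add_atTop_nhds_zero_nat)
    exact (hC.union hD).mem_of_closedBall_inter_nonempty (Eventually.of_forall hyn) hyt (hρt hyt)
  · have hti := eventually_mem_interior hM ht
    have htd := interior_subset ht
    have htt := tendsto_val hM hL htd (hti.mono fun i hi => have := interior_subset hi; this)
      tendsto_const_nhds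
    exact hC.mem_of_closedBall_inter_nonempty (hti.mono fun i hi => (hφ i).flow_mem j t hi) htt
      (hρt htt)
  · have hconv : Convex ℝ {s : ℝ | (s, j) ∈ ψ.dom} :=
      (ψ.isHybridTimeDomain.ordConnected j).convex
    filter_upwards [measure_eq_zero_iff_ae_notMem.1 (hconv.addHaar_frontier volume)] with t ht htd
    have hti : t ∈ interior {s : ℝ | (s, j) ∈ ψ.dom} := by
      by_contra h
      exact ht ⟨subset_closure htd, h⟩
    exact ⟨_, by rw [hF]; rfl, hasDerivAt_graphicalLimit hF hf hρ hδ0 hδ hφ hM hL hti⟩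
  · obtain ⟨s, hs, hs1, hs2⟩ := exists_tendsto_jump hM hL h1 h2
    exact mem_jump_of_tendsto hD hG hGb hρ hδ0 hδ
      (hs.mono fun i hi => ((hφ i).jump _ j hi.1 hi.2).2) hs1 hs2

end Limit

/-- A hybrid system with closed data, continuous flow map, outer semicontinuous jump map, and linear
growth of both maps is well-posed. Linear growth excludes the second alternative in the definition
of well-posedness. -/
theorem wellPosed_of_linear_growth [ProperSpace E] (hC : IsClosed H.C) (hD : IsClosed H.D)
    (hF : ∀ x, H.F x = {f x}) (hf : Continuous f) (hG : OuterSemicontOn H.G H.D)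
    (hGb : LocallyBoundedOn H.G H.D) {a c : ℝ} (ha : 0 ≤ a) (hc : 0 ≤ c)
    (hfa : ∀ y, ‖f y‖ ≤ a * (1 + ‖y‖)) (hGc : ∀ y ∈ H.D, ∀ g ∈ H.G y, ‖g‖ ≤ ‖y‖ + c) :
    H.WellPosed := by
  intro ρ hρ _ δ hδ0 hδ φ x₀ M hφ hM hx₀
  have hδ0' : ∀ i, 0 ≤ δ i := fun i => (hδ0 i).le
  have hb := locallyEventuallyBounded_of_linear_growth hF ha hc hfa hGc hρ hδ0' hδ hφ hx₀
  refine ⟨fun _ => ?_, fun h => absurd hb h⟩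
  have hL := locallyEventuallyLipschitz hF hf hρ hδ0' hδ hφ hb
  have h0 : (0, 0, x₀) ∈ M :=
    hM.mem_of_tendsto le_rfl (y := fun i => (0, 0, (φ i).val 0 0))
      (Eventually.of_forall fun i => ⟨(φ i).isHybridTimeDomain.zero_mem, rfl⟩)
      (tendsto_const_nhds.prodMk_nhds (tendsto_const_nhds.prodMk_nhds hx₀))
  obtain ⟨ψ, rfl⟩ := exists_hybridArc_graph_eq hM hb hL ⟨_, h0⟩
  exact ⟨ψ, isSolution_graphicalLimit hC hD hF hf hG hGb hρ hδ0' hδ hφ hM hL,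
    (ψ.mem_graph_iff.1 h0).2.symm, rfl⟩

end HybridSystem

/-! ### The closed-loop system -/

/-- The saturation is a clamp; unlike `Real.sign`, this form is visibly continuous. -/
theorem min_abs_mul_sign {u : ℝ} (hu : 0 ≤ u) (v : ℝ) :
    min |v| u * Real.sign v = max (-u) (min v u) := by
  rcases lt_trichotomy v 0 with h | rfl | h
  · rw [Real.sign_of_neg h, abs_of_neg h, min_eq_left (h.le.trans hu), mul_neg_one, ← max_neg_neg,
      neg_neg, max_comm]
  · simp [hu]
  · rw [Real.sign_of_pos h, abs_of_pos h, mul_one, max_eq_right]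
    exact le_min (by linarith) (by linarith)

theorem continuous_dzVec {m : ℕ} {u : Fin m → ℝ} (hu : ∀ k, 0 ≤ u k) : Continuous (dzVec u) := by
  have h : dzVec u = fun y k => max (-u k) (min (y k) (u k)) - y k := by
    ext y k
    simp only [dzVec, satVec, Pi.sub_apply, min_abs_mul_sign (hu k)]
  rw [h]
  fun_prop

theorem norm_dzVec_le {m : ℕ} {u : Fin m → ℝ} (hu : ∀ k, 0 ≤ u k) (y : Fin m → ℝ) :
    ‖dzVec u y‖ ≤ ‖y‖ := by
  refine (pi_norm_le_iff_of_nonneg (norm_nonneg _)).2 fun k => le_trans ?_ (norm_le_pi_norm y k)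
  simp only [dzVec, satVec, Pi.sub_apply, min_abs_mul_sign (hu k), Real.norm_eq_abs]
  have := hu k
  rcases max_cases (-u k) (min (y k) (u k)) with h | h <;>
    rcases min_cases (y k) (u k) with h' | h' <;>
    rcases abs_cases (y k) with h'' | h'' <;> rw [abs_le] <;> constructor <;> linarith

theorem EuclideanSpace.norm_le_add_of_forall_abs_le {ι : Type*} [Fintype ι]
    {x y z : EuclideanSpace ℝ ι} (h : ∀ k, |x k| ≤ |y k| + |z k|) : ‖x‖ ≤ ‖y‖ + ‖z‖ := by
  have habs : ∀ w : EuclideanSpace ℝ ι, ‖WithLp.toLp 2 (fun k => |w k|)‖ = ‖w‖ := fun w => by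
    simp [EuclideanSpace.norm_eq]
  rw [← habs y, ← habs z]
  refine le_trans ?_ (norm_add_le _ _)
  rw [EuclideanSpace.norm_eq, EuclideanSpace.norm_eq]
  refine Real.sqrt_le_sqrt (Finset.sum_le_sum fun k _ => ?_)
  simp only [PiLp.add_apply, Real.norm_eq_abs, sq_abs]
  exact sq_le_sq' (by linarith [neg_abs_le (x k), h k]) ((le_abs_self _).trans (h k))

namespace ClosedLoop

variable {q m : ℕ} {ν : Fin q → ℕ}

theorem continuous_xbar : Continuous (xbar : ClState ν → _) := by unfold xbar; fun_prop

theorem continuous_xp : Continuous (xp : ClState ν → _) := by unfold xp; fun_prop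

theorem continuous_err : Continuous (err : ClState ν → _) := by unfold err; fun_prop

theorem continuous_timer : Continuous (timer : ClState ν → _) := by unfold timer; fun_prop

theorem isClosed_timerSet (T₂ : Fin q → ℝ) : IsClosed (timerSet T₂) := by
  have : timerSet T₂ = Set.pi univ fun i => Icc 0 (T₂ i) := by
    ext; simp only [timerSet, mem_ofPred_eq, mem_univ_pi]
  rw [this]
  exact isClosed_set_pi fun i _ => isClosed_Icc

theorem isClosed_timerJumpSet (T₂ : Fin q → ℝ) (i : Fin q) : IsClosed (timerJumpSet T₂ i) :=
  (isClosed_timerSet T₂).inter (isClosed_singleton.preimage (continuous_apply i))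

theorem isClosed_flowSet (T₂ : Fin q → ℝ) : IsClosed (flowSet ν T₂) :=
  (isClosed_timerSet T₂).preimage continuous_timer

theorem isClosed_jumpSet (T₂ : Fin q → ℝ) : IsClosed (jumpSet ν T₂) :=
  (isClosed_iUnion_of_finite (isClosed_timerJumpSet T₂)).preimage continuous_timer

theorem errReset_apply (i : Fin q) (e : Blk ν → ℝ) (k : Blk ν) :
    errReset i e k = if i = k.1 then 0 else e k := by
  have h : Matrix.blockDiagonal' (fun j : Fin q =>
      if i = j then (0 : Matrix (Fin (ν j)) (Fin (ν j)) ℝ) else 1) =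
      Matrix.diagonal fun k : Blk ν => if i = k.1 then (0 : ℝ) else 1 := by
    have : (fun j : Fin q => if i = j then (0 : Matrix (Fin (ν j)) (Fin (ν j)) ℝ) else 1) =
        fun j => Matrix.diagonal fun _ => if i = j then (0 : ℝ) else 1 := by
      ext j : 1
      split_ifs <;> simp
    rw [this, Matrix.blockDiagonal'_diagonal]
  rw [errReset, h, Matrix.mulVec_diagonal]
  split_ifs <;> simp

theorem continuous_errReset (i : Fin q) : Continuous (errReset (ν := ν) i) :=
  continuous_const.matrix_mulVec continuous_id

/-- The graph of the jump map is a finite union of closed sets, one for each timer that may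
expire. -/
theorem isClosed_graph_jumpMap (T₁ T₂ : Fin q → ℝ) :
    IsClosed {p : ClState ν × ClState ν | p.2 ∈ jumpMap T₁ T₂ p.1} := by
  have h : {p : ClState ν × ClState ν | p.2 ∈ jumpMap T₁ T₂ p.1} = ⋃ i : Fin q,
      {p | xp p.2 = xp p.1} ∩ {p | timer p.1 ∈ timerJumpSet T₂ i} ∩
        {p | err p.2 = errReset i (err p.1)} ∩ {p | timer p.2 i ∈ Icc (T₁ i) (T₂ i)} ∩
        ⋂ k : Fin q, ⋂ _ : k ≠ i, {p | timer p.2 k = timer p.1 k} := by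
    ext p
    simp only [jumpMap, resetSet, timerReset, mem_ofPred_eq, mem_iUnion, mem_inter_iff, mem_iInter,
      mem_prod, mem_singleton_iff, exists_prop]
    tauto
  rw [h]
  have c1 := continuous_xp (ν := ν)
  have c2 := continuous_err (ν := ν)
  have c3 := continuous_timer (ν := ν)
  refine isClosed_iUnion_of_finite fun i => ?_
  have c4 := continuous_errReset (ν := ν) i
  refine ((((isClosed_eq (by fun_prop) (by fun_prop)).inter
    ((isClosed_timerJumpSet T₂ i).preimage (c3.comp continuous_fst))).inter
    (isClosed_eq (by fun_prop) (by fun_prop))).inter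
    (isClosed_Icc.preimage ((continuous_apply i).comp (c3.comp continuous_snd)))).inter ?_
  exact isClosed_iInter fun k => isClosed_iInter fun _ => isClosed_eq (by fun_prop) (by fun_prop)

theorem outerSemicontOn_jumpMap (T₁ T₂ : Fin q → ℝ) (S : Set (ClState ν)) :
    OuterSemicontOn (jumpMap T₁ T₂) S :=
  fun _ _ _ _ _ _ hys hx hy => (isClosed_graph_jumpMap T₁ T₂).mem_of_tendsto
    (hx.prodMk_nhds hy) (Eventually.of_forall hys)

theorem norm_le_of_mem_jumpMap {T₁ T₂ : Fin q → ℝ} (hT₁ : ∀ i, 0 ≤ T₁ i) {x g : ClState ν}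
    (hg : g ∈ jumpMap T₁ T₂ x) : ‖g‖ ≤ ‖x‖ + ‖(WithLp.toLp 2 (Sum.elim 0 T₂) : ClState ν)‖ := by
  obtain ⟨hp, hr⟩ := hg
  simp only [resetSet, mem_iUnion, mem_prod, mem_singleton_iff] at hr
  obtain ⟨i, -, he, hi, hk⟩ := hr
  refine EuclideanSpace.norm_le_add_of_forall_abs_le fun k => ?_
  rcases k with (k | k) | k
  · have : g (Sum.inl (Sum.inl k)) = x (Sum.inl (Sum.inl k)) := congrFun hp k
    rw [this]
    exact le_add_of_nonneg_right (abs_nonneg _)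
  · have : g (Sum.inl (Sum.inr k)) = errReset i (err x) k := congrFun he k
    rw [this, errReset_apply]
    refine le_add_of_le_of_nonneg ?_ (abs_nonneg _)
    split_ifs
    · simp
    · exact le_rfl
  · by_cases hki : k = i
    · subst hki
      have h0 : 0 ≤ g (Sum.inr k) := (hT₁ k).trans hi.1
      rw [abs_of_nonneg h0]
      exact le_add_of_nonneg_of_le (abs_nonneg _) (hi.2.trans (le_abs_self _))
    · have : g (Sum.inr k) = x (Sum.inr k) := hk k hki
      rw [this]
      exact le_add_of_nonneg_right (abs_nonneg _)

theorem locallyBoundedOn_jumpMap {T₁ T₂ : Fin q → ℝ} (hT₁ : ∀ i, 0 ≤ T₁ i)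
    (S : Set (ClState ν)) : LocallyBoundedOn (jumpMap T₁ T₂) S := by
  intro x _
  refine ⟨Metric.ball x 1, Metric.ball_mem_nhds x one_pos, (Metric.isBounded_closedBall (x := 0)
    (r := ‖x‖ + 1 + ‖(WithLp.toLp 2 (Sum.elim 0 T₂) : ClState ν)‖)).subset ?_⟩
  refine iUnion₂_subset fun z hz g hg => ?_
  rw [mem_closedBall_zero_iff]
  have h1 := norm_le_of_mem_jumpMap hT₁ hg
  have h2 := mem_ball_iff_norm.1 hz.1
  linarith [norm_le_norm_add_norm_sub' z x]

variable (A : Matrix (Blk ν) (Blk ν) ℝ) (B : Matrix (Blk ν) (Fin m) ℝ)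
  (K : Matrix (Fin m) (Blk ν) ℝ) {u : Fin m → ℝ}

theorem continuous_flowMap (hu : ∀ k, 0 ≤ u k) : Continuous (flowMap A B K u) := by
  have c1 := continuous_dzVec hu
  have c2 := continuous_xbar (ν := ν)
  have c3 : Continuous fun x : ClState ν => (Acl A B K).mulVec (xbar x) +
      (Bcl B).mulVec (dzVec u ((Kcl K).mulVec (xbar x))) :=
    (continuous_const.matrix_mulVec c2).add
      (continuous_const.matrix_mulVec (c1.comp (continuous_const.matrix_mulVec c2)))
  refine (PiLp.continuous_toLp 2 _).comp (continuous_pi fun k => ?_)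
  rcases k with k | k
  · exact (continuous_apply k).comp c3
  · exact continuous_const

theorem exists_norm_flowMap_le (hu : ∀ k, 0 ≤ u k) :
    ∃ a, 0 ≤ a ∧ ∀ x, ‖flowMap A B K u x‖ ≤ a * (1 + ‖x‖) := by
  have hmul : ∀ {ι κ : Type} [Fintype ι] [Fintype κ] (N : Matrix ι κ ℝ),
      ∃ c, 0 ≤ c ∧ ∀ v, ‖N.mulVec v‖ ≤ c * ‖v‖ := fun {ι κ} _ _ N =>
    ⟨_, norm_nonneg _, (LinearMap.toContinuousLinearMap N.mulVecLin).le_opNorm⟩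
  obtain ⟨α, hα, hA⟩ := hmul (Acl A B K)
  obtain ⟨β, hβ, hB⟩ := hmul (Bcl B)
  obtain ⟨κ, hκ, hK⟩ := hmul (Kcl K)
  set P := (EuclideanSpace.equiv ((Blk ν ⊕ Blk ν) ⊕ Fin q) ℝ).symm.toContinuousLinearMap
  refine ⟨‖P‖ * (α + β * κ + 1), by positivity, fun x => ?_⟩
  have hx : ‖xbar x‖ ≤ ‖x‖ := (pi_norm_le_iff_of_nonneg (norm_nonneg _)).2 fun k =>
    PiLp.norm_apply_le x (Sum.inl k)
  set v := (Acl A B K).mulVec (xbar x) + (Bcl B).mulVec (dzVec u ((Kcl K).mulVec (xbar x)))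
    with hv
  have hvn : ‖v‖ ≤ (α + β * κ) * ‖x‖ :=
    calc ‖v‖ ≤ α * ‖xbar x‖ + β * (κ * ‖xbar x‖) := (norm_add_le _ _).trans <|
          add_le_add (hA _) <| (hB _).trans <|
            mul_le_mul_of_nonneg_left ((norm_dzVec_le hu _).trans (hK _)) hβ
      _ = (α + β * κ) * ‖xbar x‖ := by ring
      _ ≤ _ := by gcongr
  have hw : ‖(Sum.elim v (fun _ => -1) : (Blk ν ⊕ Blk ν) ⊕ Fin q → ℝ)‖ ≤ ‖v‖ + 1 := by
    refine (pi_norm_le_iff_of_nonneg (by positivity)).2 fun k => ?_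
    rcases k with k | k
    · exact (norm_le_pi_norm v k).trans (by linarith)
    · simp
  have hc : 0 ≤ α + β * κ := by positivity
  calc ‖flowMap A B K u x‖ = ‖P (Sum.elim v fun _ => -1)‖ := rfl
    _ ≤ ‖P‖ * ‖(Sum.elim v (fun _ => -1) : (Blk ν ⊕ Blk ν) ⊕ Fin q → ℝ)‖ := P.le_opNorm _
    _ ≤ ‖P‖ * ((α + β * κ + 1) * (1 + ‖x‖)) := by
      gcongr
      nlinarith [norm_nonneg x]
    _ = _ := by ring

end ClosedLoop

theorem lemma1 {q m : ℕ} (ν : Fin q → ℕ)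
    (A : Matrix (Blk ν) (Blk ν) ℝ) (B : Matrix (Blk ν) (Fin m) ℝ) (K : Matrix (Fin m) (Blk ν) ℝ)
    (u : Fin m → ℝ) (hu : ∀ k, 0 < u k)
    (T₁ T₂ : Fin q → ℝ) (hT₁ : ∀ i, 0 < T₁ i) (hT₁₂ : ∀ i, T₁ i ≤ T₂ i) :
    IsClosed (ClosedLoop.flowSet ν T₂) ∧
    IsClosed (ClosedLoop.jumpSet ν T₂) ∧
    Continuous (ClosedLoop.flowMap A B K u) ∧
    OuterSemicontOn (ClosedLoop.jumpMap (ν := ν) T₁ T₂) (ClosedLoop.jumpSet ν T₂) ∧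
    LocallyBoundedOn (ClosedLoop.jumpMap (ν := ν) T₁ T₂) (ClosedLoop.jumpSet ν T₂) ∧
    (ClosedLoop.system A B K u T₁ T₂).WellPosed := by
  have hu' : ∀ k, 0 ≤ u k := fun k => (hu k).le
  have hT₁' : ∀ i, 0 ≤ T₁ i := fun i => (hT₁ i).le
  have hC := ClosedLoop.isClosed_flowSet (ν := ν) T₂
  have hD := ClosedLoop.isClosed_jumpSet (ν := ν) T₂
  have hf := ClosedLoop.continuous_flowMap A B K hu'
  have hG := ClosedLoop.outerSemicontOn_jumpMap T₁ T₂ (ClosedLoop.jumpSet ν T₂)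
  have hGb := ClosedLoop.locallyBoundedOn_jumpMap (T₂ := T₂) hT₁' (ClosedLoop.jumpSet ν T₂)
  obtain ⟨a, ha, hfa⟩ := ClosedLoop.exists_norm_flowMap_le A B K hu'
  exact ⟨hC, hD, hf, hG, hGb, HybridSystem.wellPosed_of_linear_growth hC hD (fun _ => rfl) hf hG hGb
    ha (norm_nonneg _) hfa fun y _ g hg => ClosedLoop.norm_le_of_mem_jumpMap hT₁' hg⟩
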